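/- Let $\Omega\subset\mathbb R^2$ be a bounded connected open set with $C^3$ boundary $\partial\Omega$ of length $L$. Let $\gamma:[0,L)\to\partial\Omega$ be a parametrization of $\partial\Omega$ by arc length, $|\gamma'(s)|=1$ (if $\partial\Omega$ has several connected components, $\gamma$ runs through them one after the other). Let $\alpha(s)\in\mathbb R$ be such that $\boldsymbol n(s)=(\cos\alpha(s),\sin\alpha(s))$ is the outward unit normal of $\Omega$ at $\gamma(s)$. Put $$\sigma_1=\begin{pmatrix}0&1\\1&0\end{pmatrix},\quad \sigma_2=\begin{pmatrix}0&-i\\i&0\end{pmatrix},\quad \sigma_3=i\sigma_2\sigma_1,\qquad A(s)=\begin{pmatrix}0&a(s)^*\\a(s)&0\end{pmatrix},\quad a(s)=ie^{i\alpha(s)},\quad P_\pm(s)=\tfrac12(1\pm A(s)).$$ For $M>0$ let $H_M$ be the operator in $L^2(\mathbb R^2,\mathbb C^2)$ with domain $H^1(\mathbb R^2,\mathbb C^2)$ given by $$H_M\psi=\tfrac1i(\sigma_1\partial_1\psi+\sigma_2\partial_2\psi)+M\sigma_3(1-\mathbb 1_\Omega)\psi .$$ Then for every $M>0$ and every $\psi\in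 H^1(\mathbb R^2,\mathbb C^2)$ the boundary trace $s\mapsto\psi(\gamma(s))$ exists in $L^2((0,L),\mathbb C^2)$ (as the $L^2$-limit of the boundary values of Schwartz functions converging to $\psi$ in $H^1$), and for this trace $$\|H_M\psi\|^2=\int_{\mathbb R^2}|\nabla\psi(x)|^2\,dx+M^2\int_{\mathbb R^2\setminus\Omega}|\psi(x)|^2\,dx-M\int_0^L\Big(|P_+(s)\psi(\gamma(s))|^2-|P_-(s)\psi(\gamma(s))|^2\Big)ds .$$ -/

import Mathlib

open MeasureTheory Filter Topology
open scoped SchwartzMap LineDeriv ENNReal InnerProductSpace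

/-- The Euclidean plane `ℝ²`. -/
abbrev Plane : Type := EuclideanSpace ℝ (Fin 2)

/-- The space `ℂ²` with its Hermitian scalar product. -/
abbrev Spinor : Type := EuclideanSpace ℂ (Fin 2)

/-- The Hilbert space `L²(ℝ², ℂ²)`. -/
abbrev SpinorL2 : Type := Lp Spinor 2 (volume : Measure Plane)

/-- The standard basis vectors of `ℝ²`. -/
noncomputable def planeBasis (j : Fin 2) : Plane := EuclideanSpace.single j (1 : ℝ)

/-! ### The Sobolev space `H¹(ℝ², ℂ²)` and its weak derivatives -/

/-- The Sobolev space `H¹(ℝ², ℂ²)` as a subspace of `L²(ℝ², ℂ²)`. -/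
noncomputable def spinorH1 : Submodule ℂ SpinorL2 where
  carrier := {ψ | TemperedDistribution.MemSobolev 1 2 (ψ : 𝓢'(Plane, Spinor))}
  zero_mem' := by
    have h := TemperedDistribution.memSobolev_fun_zero Plane Spinor 1 2
    rw [← map_zero (Lp.toTemperedDistributionCLM Spinor (volume : Measure Plane) 2)] at h
    exact h
  add_mem' := by
    intro f g hf hg
    have h := hf.add hg
    simp only [← Lp.toTemperedDistributionCLM_apply, ← map_add] at h
    exact h
  smul_mem' := by
    intro c f hf
    have h := hf.smul c
    simp only [← Lp.toTemperedDistributionCLM_apply, ← map_smul] at h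
    exact h

theorem exists_weakDeriv (v : Plane) (ψ : spinorH1) :
    ∃ g : SpinorL2, ∂_{v} ((ψ : SpinorL2) : 𝓢'(Plane, Spinor)) = (g : 𝓢'(Plane, Spinor)) := by
  have hψ : TemperedDistribution.MemSobolev 1 2 ((ψ : SpinorL2) : 𝓢'(Plane, Spinor)) := ψ.2
  have h := hψ.lineDerivOp (m := v)
  rw [sub_self] at h
  exact TemperedDistribution.memSobolev_zero_iff.mp h

theorem toTemperedDistribution_inj {f g : SpinorL2}
    (h : (f : 𝓢'(Plane, Spinor)) = (g : 𝓢'(Plane, Spinor))) : f = g :=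
  LinearMap.ker_eq_bot.mp
    (Lp.ker_toTemperedDistributionCLM_eq_bot (F := Spinor) (μ := (volume : Measure Plane))
      (p := 2)) h

theorem weakDeriv_add_aux (v : Plane) (f g : spinorH1) :
    (exists_weakDeriv v (f + g)).choose =
      (exists_weakDeriv v f).choose + (exists_weakDeriv v g).choose := by
  apply toTemperedDistribution_inj
  rw [← (exists_weakDeriv v (f + g)).choose_spec]
  have h1 := map_add (Lp.toTemperedDistributionCLM Spinor (volume : Measure Plane) 2)
    (f : SpinorL2) (g : SpinorL2)
  have h2 := map_add (Lp.toTemperedDistributionCLM Spinor (volume : Measure Plane) 2)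
    (exists_weakDeriv v f).choose (exists_weakDeriv v g).choose
  refine Eq.trans (congrArg (fun u : 𝓢'(Plane, Spinor) => ∂_{v} u) h1) ?_
  refine (LineDeriv.lineDerivOp_add v _ _).trans (Eq.trans ?_ h2.symm)
  exact congrArg₂ (· + ·) (exists_weakDeriv v f).choose_spec (exists_weakDeriv v g).choose_spec

theorem weakDeriv_smul_aux (v : Plane) (c : ℂ) (f : spinorH1) :
    (exists_weakDeriv v (c • f)).choose = c • (exists_weakDeriv v f).choose := by
  apply toTemperedDistribution_inj
  rw [← (exists_weakDeriv v (c • f)).choose_spec]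
  have h1 := map_smul (Lp.toTemperedDistributionCLM Spinor (volume : Measure Plane) 2)
    c (f : SpinorL2)
  have h2 := map_smul (Lp.toTemperedDistributionCLM Spinor (volume : Measure Plane) 2)
    c (exists_weakDeriv v f).choose
  refine Eq.trans (congrArg (fun u : 𝓢'(Plane, Spinor) => ∂_{v} u) h1) ?_
  refine (LineDeriv.lineDerivOp_smul v c _).trans (Eq.trans ?_ h2.symm)
  exact congrArg (c • ·) (exists_weakDeriv v f).choose_spec

/-- The weak derivative of `ψ ∈ H¹(ℝ², ℂ²)` in the direction `v`: the element of `L²(ℝ², ℂ²)` that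
represents the distributional derivative. -/
noncomputable def weakDeriv (v : Plane) : spinorH1 →ₗ[ℂ] SpinorL2 where
  toFun ψ := (exists_weakDeriv v ψ).choose
  map_add' f g := weakDeriv_add_aux v f g
  map_smul' c f := weakDeriv_smul_aux v c f

/-! ### The Dirac operator with a mass term outside of `Ω` -/

/-- The first Pauli matrix. -/
noncomputable def pauli₁ : Matrix (Fin 2) (Fin 2) ℂ := !![0, 1; 1, 0]

/-- The second Pauli matrix. -/
noncomputable def pauli₂ : Matrix (Fin 2) (Fin 2) ℂ := !![0, -Complex.I; Complex.I, 0]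

/-- The third Pauli matrix `σ₃ = i σ₂ σ₁`. -/
noncomputable def pauli₃ : Matrix (Fin 2) (Fin 2) ℂ := Complex.I • (pauli₂ * pauli₁)

/-- A matrix acting on `ℂ²`. -/
noncomputable def matAct (A : Matrix (Fin 2) (Fin 2) ℂ) : Spinor →L[ℂ] Spinor :=
  Matrix.toEuclideanCLM (n := Fin 2) (𝕜 := ℂ) A

/-- A constant matrix acting pointwise on `L²(ℝ², ℂ²)`. -/
noncomputable def matActL2 (A : Matrix (Fin 2) (Fin 2) ℂ) : SpinorL2 →ₗ[ℂ] SpinorL2 :=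
  ContinuousLinearMap.toLinearMap
    (ContinuousLinearMap.compLpL 2 (volume : Measure Plane) (matAct A))

theorem memLp_cutOutside (Ω : TopologicalSpace.Opens Plane) (ψ : SpinorL2) :
    MemLp ((Ω : Set Plane)ᶜ.indicator (ψ : Plane → Spinor)) 2 (volume : Measure Plane) :=
  (Lp.memLp ψ).indicator Ω.isOpen.measurableSet.compl

/-- Multiplication by `1 - 𝟙_Ω` on `L²(ℝ², ℂ²)`, for an open set `Ω`. -/
noncomputable def cutOutside (Ω : TopologicalSpace.Opens Plane) : SpinorL2 →ₗ[ℂ] SpinorL2 where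
  toFun ψ := (memLp_cutOutside Ω ψ).toLp ((Ω : Set Plane)ᶜ.indicator (ψ : Plane → Spinor))
  map_add' f g := by
    rw [← MemLp.toLp_add]
    apply MemLp.toLp_congr
    rw [← Set.indicator_add']
    exact (Lp.coeFn_add f g).indicator
  map_smul' c f := by
    rw [RingHom.id_apply, ← MemLp.toLp_const_smul]
    apply MemLp.toLp_congr
    exact (Lp.coeFn_smul c f).indicator.trans
      (EventuallyEq.of_eq (Set.indicator_const_smul (Ω : Set Plane)ᶜ c f))

/-- The massless Dirac operator `T ψ = (1/i) (σ₁ ∂₁ψ + σ₂ ∂₂ψ)` on `H¹(ℝ², ℂ²)`. -/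
noncomputable def diracT : spinorH1 →ₗ[ℂ] SpinorL2 :=
  (1 / Complex.I) • (matActL2 pauli₁ ∘ₗ weakDeriv (planeBasis 0) +
    matActL2 pauli₂ ∘ₗ weakDeriv (planeBasis 1))

/-- The operator `H_M ψ = T ψ + σ₃ M (1 - 𝟙_Ω) ψ` in `L²(ℝ², ℂ²)` with domain `H¹(ℝ², ℂ²)`. -/
noncomputable def diracHM (Ω : TopologicalSpace.Opens Plane) (M : ℝ) :
    SpinorL2 →ₗ.[ℂ] SpinorL2 where
  domain := spinorH1
  toFun := diracT + (M : ℂ) • (matActL2 pauli₃ ∘ₗ cutOutside Ω ∘ₗ spinorH1.subtype)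

/-! ### The boundary of `Ω` -/

/-- `Ω` has a `C³` boundary: near each boundary point it is, in suitable orthonormal coordinates,
the part of the plane above the graph of a `C³` function. -/
def HasC3Boundary (Ω : Set Plane) : Prop :=
  ∀ x ∈ frontier Ω, ∃ r > 0, ∃ (e : Plane ≃ₗᵢ[ℝ] Plane) (g : ℝ → ℝ), ContDiff ℝ 3 g ∧
    Ω ∩ Metric.ball x r = {y | g (e y 0) < e y 1} ∩ Metric.ball x r

/-- `γ`, restricted to `[0, L)`, runs through `∂Ω` once in its arc length. The boundary may have
several connected components: `[0, L)` is cut into finitely many intervals `[t k, t (k + 1))`, on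
each of which `γ` is one full period of a closed `C³` curve of unit speed. -/
structure IsArcLengthParam (Ω : Set Plane) (L : ℝ) (γ : ℝ → Plane) : Prop where
  closed_curves : ∃ (m : ℕ) (t : Fin (m + 1) → ℝ), StrictMono t ∧ t 0 = 0 ∧ t (Fin.last m) = L ∧
    ∀ k : Fin m, ∃ c : ℝ → Plane, ContDiff ℝ 3 c ∧
      Function.Periodic c (t k.succ - t k.castSucc) ∧ (∀ s, ‖deriv c s‖ = 1) ∧
      Set.EqOn γ c (Set.Ico (t k.castSucc) (t k.succ))
  injOn : Set.InjOn γ (Set.Ico 0 L)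
  image_eq : γ '' Set.Ico 0 L = frontier Ω

/-- `ν` is the outward unit normal vector of `Ω` at the boundary point `x`: directions `v` that form
an obtuse angle with `ν` lead from `x` into `Ω`, those that form an acute angle with `ν` lead into
the exterior of `Ω`. -/
structure IsOutwardUnitNormal (Ω : Set Plane) (x ν : Plane) : Prop where
  mem_frontier : x ∈ frontier Ω
  norm_eq : ‖ν‖ = 1
  inner_neg : ∀ v : Plane, ⟪v, ν⟫_ℝ < 0 → ∀ᶠ t in 𝓝[>] (0 : ℝ), x + t • v ∈ Ω
  inner_pos : ∀ v : Plane, 0 < ⟪v, ν⟫_ℝ → ∀ᶠ t in 𝓝[>] (0 : ℝ), x + t • v ∉ closure Ω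

/-- The matrix `A` with entries `0, a*, a, 0`, where `a = i e^{iα}`. -/
noncomputable def boundaryMatrix (α : ℝ) : Matrix (Fin 2) (Fin 2) ℂ :=
  !![0, starRingEnd ℂ (Complex.I * Complex.exp (Complex.I * α));
    Complex.I * Complex.exp (Complex.I * α), 0]

/-- The projection `P₊ = (1 + A) / 2`. -/
noncomputable def projPlus (α : ℝ) : Matrix (Fin 2) (Fin 2) ℂ :=
  (1 / 2 : ℂ) • (1 + boundaryMatrix α)

/-- The projection `P₋ = (1 - A) / 2`. -/
noncomputable def projMinus (α : ℝ) : Matrix (Fin 2) (Fin 2) ℂ :=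
  (1 / 2 : ℂ) • (1 - boundaryMatrix α)

/-- `τ` is the boundary trace `s ↦ ψ(γ(s))`, an element of `L²(0, L)`, of `ψ ∈ H¹(ℝ², ℂ²)`: it is
the `L²`-limit of the boundary values of Schwartz functions that converge to `ψ` in `H¹`. -/
def IsBoundaryTrace (L : ℝ) (γ : ℝ → Plane) (ψ : spinorH1) (τ : ℝ → Spinor) : Prop :=
  MemLp τ 2 (volume.restrict (Set.Ico 0 L)) ∧
  ∃ φ : ℕ → 𝓢(Plane, Spinor),
    Tendsto (fun n => (φ n).toLp 2 (volume : Measure Plane)) atTop (𝓝 (ψ : SpinorL2)) ∧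
    (∀ j : Fin 2, Tendsto (fun n => (∂_{planeBasis j} (φ n)).toLp 2 (volume : Measure Plane)) atTop
      (𝓝 (weakDeriv (planeBasis j) ψ))) ∧
    Tendsto (fun n => eLpNorm (fun s => φ n (γ s) - τ s) 2 (volume.restrict (Set.Ico 0 L))) atTop
      (𝓝 0)

/-! Pointwise, `|H_M φ|²` expands into `|∇φ|²`, the mass term `M² |φ|²` off `Ω`, and two cross
terms. The first, `2 Re ⟨∂₁φ, σ₁σ₂ ∂₂φ⟩`, has an antisymmetric real form because `σ₁σ₂` is
anti-Hermitian, and integrates to zero over the plane since partial derivatives commute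
(`integral_cross_derivative_eq_zero`). The second couples `∇φ` to the mass. As `iσ₁σ₃ = σ₂` and
`iσ₂σ₃ = -σ₁` are Hermitian, it is `M` times the divergence of the field with components `⟨φ, σ₂ φ⟩`
and `-⟨φ, σ₁ φ⟩` (`fluxForm`), integrated over the complement of `Ω`. The divergence theorem turns
this into minus the boundary integral of the flux through `n`. Since `cos α σ₂ - sin α σ₁ = A`, that
flux is `⟨φ, A φ⟩ = |P₊φ|² - |P₋φ|²`. This settles Schwartz functions
(`norm_sq_diracAction_schwartz`).

The general case is a limit. Schwartz functions are dense in `H¹` (`exists_schwartz_tendsto`), and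
every term of the identity is continuous in the `L²` classes of `ψ`, `∂₁ψ`, `∂₂ψ` and in the trace.
The trace inequality (`exists_trace_bound`) makes the boundary values of an approximating sequence
Cauchy, so a trace exists.

The analytic base is the divergence theorem on `Ω` (`setIntegral_fderiv_eq_boundary`). Fubini and a
shear give it above a graph, a change of variables rewrites the graph integral in arc length, and
bump functions patch the charts together. -/

/-! ### The divergence theorem above a graph -/

/-- The divergence theorem in the upper half plane, for the field `h • (a, c)` where `c` depends on
the first variable only. -/
theorem setIntegral_upperHalf_fderiv {h : ℝ × ℝ → ℝ} (hh : ContDiff ℝ 1 h)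
    (hc : HasCompactSupport h) (a : ℝ) {c : ℝ → ℝ} (hcc : Continuous c) :
    ∫ p in (Set.univ : Set ℝ) ×ˢ Set.Ioi (0 : ℝ), fderiv ℝ h p (a, c p.1) =
      -∫ u, c u * h (u, 0) := by
  have hcf : Continuous (fderiv ℝ h) := hh.continuous_fderiv one_ne_zero
  have hd : Differentiable ℝ h := hh.differentiable one_ne_zero
  have hc1 : Continuous fun p => fderiv ℝ h p (1, 0) := hcf.clm_apply continuous_const
  have hc2 : Continuous fun p : ℝ × ℝ => c p.1 * fderiv ℝ h p (0, 1) :=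
    (hcc.comp continuous_fst).mul (hcf.clm_apply continuous_const)
  have hs1 : HasCompactSupport fun p => fderiv ℝ h p (1, 0) := hc.fderiv_apply (𝕜 := ℝ) _
  have hs2 : HasCompactSupport fun p : ℝ × ℝ => c p.1 * fderiv ℝ h p (0, 1) :=
    (hc.fderiv_apply (𝕜 := ℝ) (0, 1)).mul_left
  have hi1 : Integrable fun p => fderiv ℝ h p (1, 0) := hc1.integrable_of_hasCompactSupport hs1
  have hi2 : Integrable fun p : ℝ × ℝ => c p.1 * fderiv ℝ h p (0, 1) :=
    hc2.integrable_of_hasCompactSupport hs2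
  have hdec : ∀ p : ℝ × ℝ, fderiv ℝ h p (a, c p.1) =
      a * fderiv ℝ h p (1, 0) + c p.1 * fderiv ℝ h p (0, 1) := by
    intro p
    have : ((a, c p.1) : ℝ × ℝ) = a • (1, 0) + c p.1 • (0, 1) := by simp
    rw [this, map_add, map_smul, map_smul, smul_eq_mul, smul_eq_mul]
  have hemb : ∀ u : ℝ, IsClosedEmbedding fun t : ℝ => (u, t) := fun u =>
    (Isometry.of_dist_eq fun s t => by simp [Prod.dist_eq]).isClosedEmbedding
  have hemb' : ∀ t : ℝ, IsClosedEmbedding fun u : ℝ => (u, t) := fun t =>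
    (Isometry.of_dist_eq fun s t => by simp [Prod.dist_eq]).isClosedEmbedding
  have hslice : ∀ u : ℝ, HasCompactSupport fun t => h (u, t) := fun u =>
    hc.comp_isClosedEmbedding (hemb u)
  have hslice' : ∀ t : ℝ, HasCompactSupport fun u => h (u, t) := fun t =>
    hc.comp_isClosedEmbedding (hemb' t)
  have hder : ∀ u t : ℝ, HasDerivAt (fun t => h (u, t)) (fderiv ℝ h (u, t) (0, 1)) t := fun u t =>
    (hd (u, t)).hasFDerivAt.comp_hasDerivAt t ((hasDerivAt_const t u).prodMk (hasDerivAt_id t))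
  have hder' : ∀ u t : ℝ, HasDerivAt (fun u => h (u, t)) (fderiv ℝ h (u, t) (1, 0)) u := fun u t =>
    (hd (u, t)).hasFDerivAt.comp_hasDerivAt u ((hasDerivAt_id u).prodMk (hasDerivAt_const u t))
  simp_rw [hdec]
  rw [integral_add (hi1.const_mul a).integrableOn hi2.integrableOn, integral_const_mul]
  -- Along a horizontal line the derivative of a compactly supported function integrates to zero;
  -- along a vertical half line, as in `h2`, only the value at height `0` remains.
  have h1 : ∫ p in (Set.univ : Set ℝ) ×ˢ Set.Ioi (0 : ℝ), fderiv ℝ h p (1, 0) = 0 := by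
    rw [Measure.volume_eq_prod, ← Measure.prod_restrict, integral_prod_symm]
    · refine integral_eq_zero_of_ae (Eventually.of_forall fun t => ?_)
      simp only [Measure.restrict_univ, Pi.zero_apply]
      refine integral_eq_zero_of_hasDerivAt_of_integrable (fun u => hder' u t) ?_ ?_
      · exact (hc1.comp (by fun_prop)).integrable_of_hasCompactSupport
          (hs1.comp_isClosedEmbedding (hemb' t))
      · exact (hh.continuous.comp (by fun_prop)).integrable_of_hasCompactSupport (hslice' t)
    · rw [Measure.prod_restrict]; exact hi1.integrableOn
  have h2 : ∫ p in (Set.univ : Set ℝ) ×ˢ Set.Ioi (0 : ℝ), c p.1 * fderiv ℝ h p (0, 1) =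
      -∫ u, c u * h (u, 0) := by
    rw [Measure.volume_eq_prod, setIntegral_prod _ hi2.integrableOn, ← integral_neg]
    simp only [Measure.restrict_univ]
    congr 1
    ext u
    rw [integral_const_mul, ← mul_neg]
    congr 1
    have hu : ∫ t in Set.Ioi (0 : ℝ), deriv (fun t => h (u, t)) t = -h (u, 0) :=
      (hslice u).integral_Ioi_deriv_eq
      (hh.comp (contDiff_const.prodMk contDiff_id : ContDiff ℝ 1 fun t : ℝ => (u, t))) 0
    simp_rw [fun t => (hder u t).deriv] at hu
    exact hu
  rw [h1, h2, mul_zero, zero_add]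

/-- The shear `(u, t) ↦ (u, g u + t)`. -/
def shear (g : ℝ → ℝ) (hg : Continuous g) : ℝ × ℝ ≃ₜ ℝ × ℝ where
  toFun p := (p.1, g p.1 + p.2)
  invFun p := (p.1, -g p.1 + p.2)
  left_inv p := by simp
  right_inv p := by simp
  continuous_toFun := by fun_prop
  continuous_invFun := by fun_prop

theorem measurePreserving_shear (g : ℝ → ℝ) (hg : Continuous g) :
    MeasurePreserving (shear g hg) := by
  rw [Measure.volume_eq_prod]
  exact (MeasurePreserving.id volume).skew_product (g := fun u t => g u + t)
    (by fun_prop) (Eventually.of_forall fun u => map_add_left_eq_self volume (g u))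

/-- The divergence theorem above the graph of `g`, for a field `f • (a, b)` of constant
direction. -/
theorem setIntegral_epigraph_fderiv {f : ℝ × ℝ → ℝ} (hf : ContDiff ℝ 1 f)
    (hc : HasCompactSupport f) {g : ℝ → ℝ} (hg : ContDiff ℝ 1 g) (a b : ℝ) :
    ∫ p in {p : ℝ × ℝ | g p.1 < p.2}, fderiv ℝ f p (a, b) =
      ∫ u, f (u, g u) * (a * deriv g u - b) := by
  have hgd : Differentiable ℝ g := hg.differentiable one_ne_zero
  have hS : ContDiff ℝ 1 (shear g hg.continuous) :=
    contDiff_fst.prodMk ((hg.comp contDiff_fst).add contDiff_snd)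
  have hpre : shear g hg.continuous ⁻¹' {p : ℝ × ℝ | g p.1 < p.2} =
      (Set.univ : Set ℝ) ×ˢ Set.Ioi (0 : ℝ) := by
    ext p; simp [shear]
  rw [← (measurePreserving_shear g hg.continuous).setIntegral_preimage_emb
    (shear g hg.continuous).measurableEmbedding, hpre]
  -- Pulled back by the shear, the constant direction `(a, b)` becomes `(a, b - a g'(u))`. This is
  -- why the half plane version lets `c` depend on `u`.
  have key := setIntegral_upperHalf_fderiv (hf.comp hS)
    (hc.comp_homeomorph (shear g hg.continuous)) a
    (c := fun u => b - a * deriv g u)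
    (continuous_const.sub (continuous_const.mul (hg.continuous_deriv le_rfl)))
  have hrw : ∀ p : ℝ × ℝ, fderiv ℝ (f ∘ shear g hg.continuous) p (a, b - a * deriv g p.1) =
      fderiv ℝ f (shear g hg.continuous p) (a, b) := by
    intro p
    have hSd : HasFDerivAt (shear g hg.continuous)
        ((ContinuousLinearMap.fst ℝ ℝ ℝ).prod
          (deriv g p.1 • ContinuousLinearMap.fst ℝ ℝ ℝ + ContinuousLinearMap.snd ℝ ℝ ℝ)) p := by
      refine hasFDerivAt_fst.prodMk (HasFDerivAt.add ?_ hasFDerivAt_snd)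
      exact (hgd p.1).hasDerivAt.comp_hasFDerivAt p hasFDerivAt_fst
    rw [((hf.differentiable one_ne_zero _).hasFDerivAt.comp p hSd).fderiv]
    simp only [ContinuousLinearMap.comp_apply, ContinuousLinearMap.prod_apply]
    congr 1
    simp
    ring
  simp_rw [hrw] at key
  rw [key, ← integral_neg]
  congr 1
  ext u
  simp [shear]
  ring

/-- The plane point with coordinates `u`, `v` in the orthonormal coordinate system `e`. -/
noncomputable def chartPoint (e : Plane ≃ₗᵢ[ℝ] Plane) : (ℝ × ℝ) ≃L[ℝ] Plane :=
  ((ContinuousLinearEquiv.finTwoArrow ℝ ℝ).symm.trans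
    (EuclideanSpace.equiv (Fin 2) ℝ).symm).trans e.symm.toContinuousLinearEquiv

@[simp]
theorem apply_chartPoint_zero (e : Plane ≃ₗᵢ[ℝ] Plane) (p : ℝ × ℝ) : e (chartPoint e p) 0 = p.1 := by
  simp [chartPoint]

@[simp]
theorem apply_chartPoint_one (e : Plane ≃ₗᵢ[ℝ] Plane) (p : ℝ × ℝ) : e (chartPoint e p) 1 = p.2 := by
  simp [chartPoint]

theorem chartPoint_apply_eq (e : Plane ≃ₗᵢ[ℝ] Plane) (y : Plane) :
    chartPoint e (e y 0, e y 1) = y := by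
  apply e.injective
  ext i
  fin_cases i <;> simp

theorem measurePreserving_chartPoint (e : Plane ≃ₗᵢ[ℝ] Plane) :
    MeasurePreserving (chartPoint e) := by
  have h1 := (volume_preserving_finTwoArrow ℝ).symm
  have h2 := PiLp.volume_preserving_toLp (Fin 2)
  have h3 := e.symm.measurePreserving
  exact h3.comp (h2.comp h1)

/-- The divergence theorem above a graph in an orthonormal coordinate system of the plane. -/
theorem setIntegral_chart_fderiv {f : Plane → ℝ} (hf : ContDiff ℝ 1 f)
    (hc : HasCompactSupport f) {g : ℝ → ℝ} (hg : ContDiff ℝ 1 g) (e : Plane ≃ₗᵢ[ℝ] Plane)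
    (w : Plane) :
    ∫ y in {y : Plane | g (e y 0) < e y 1}, fderiv ℝ f y w =
      ∫ u, f (chartPoint e (u, g u)) * (e w 0 * deriv g u - e w 1) := by
  have key := setIntegral_epigraph_fderiv (hf.comp (chartPoint e).contDiff)
    (hc.comp_homeomorph (chartPoint e).toHomeomorph) hg (e w 0) (e w 1)
  have hpre : chartPoint e ⁻¹' {y : Plane | g (e y 0) < e y 1} = {p : ℝ × ℝ | g p.1 < p.2} := by
    ext p; simp
  rw [← (measurePreserving_chartPoint e).setIntegral_preimage_emb
    (chartPoint e).toHomeomorph.measurableEmbedding, hpre]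
  have hrw : ∀ p, fderiv ℝ (f ∘ chartPoint e) p (e w 0, e w 1) =
      fderiv ℝ f (chartPoint e p) w := by
    intro p
    rw [((hf.differentiable one_ne_zero _).hasFDerivAt.comp p (chartPoint e).hasFDerivAt).fderiv,
      ContinuousLinearMap.comp_apply]
    congr 1
    exact chartPoint_apply_eq e w
  simp_rw [hrw] at key
  exact key

/-! ### Boundary charts -/

/-- Frontiers are local, so inside the ball `Ω` may be replaced by the epigraph, whose frontier is
the graph by continuity of `g`. -/
theorem mem_frontier_iff_of_chart {Ω : Set Plane} {x : Plane} {r : ℝ} {e : Plane ≃ₗᵢ[ℝ] Plane}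
    {g : ℝ → ℝ} (hg : Continuous g)
    (hch : Ω ∩ Metric.ball x r = {y | g (e y 0) < e y 1} ∩ Metric.ball x r)
    {y : Plane} (hy : y ∈ Metric.ball x r) :
    y ∈ frontier Ω ↔ g (e y 0) = e y 1 := by
  have h1 : frontier Ω ∩ Metric.ball x r =
      frontier {y : Plane | g (e y 0) < e y 1} ∩ Metric.ball x r := by
    rw [← frontier_inter_open_inter Metric.isOpen_ball, hch,
      frontier_inter_open_inter Metric.isOpen_ball]
  have h2 : y ∈ frontier Ω ↔ y ∈ frontier {y : Plane | g (e y 0) < e y 1} := by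
    constructor
    · exact fun h => (h1.subset ⟨h, hy⟩).1
    · exact fun h => (h1.superset ⟨h, hy⟩).1
  have hc0 : Continuous fun y : Plane => g (e y 0) := by fun_prop
  have hc1 : Continuous fun y : Plane => e y 1 := by fun_prop
  rw [h2]
  constructor
  · exact fun h => frontier_lt_subset_eq hc0 hc1 h
  · intro h
    rw [(isOpen_lt hc0 hc1).frontier_eq]
    refine ⟨?_, by simp [h]⟩
    -- A point of the graph is the limit of the points vertically above it, which lie in the
    -- epigraph.
    have hcont : Continuous fun t : ℝ => y + t • chartPoint e (0, 1) := by fun_prop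
    have hlim : Tendsto (fun t : ℝ => y + t • chartPoint e (0, 1)) (𝓝[>] 0) (𝓝 y) := by
      have := hcont.tendsto 0
      simp only [zero_smul, add_zero] at this
      exact this.mono_left nhdsWithin_le_nhds
    refine mem_closure_of_tendsto hlim ?_
    filter_upwards [self_mem_nhdsWithin] with t ht
    have ht' : (0 : ℝ) < t := ht
    change g (e (y + t • chartPoint e (0, 1)) 0) < e (y + t • chartPoint e (0, 1)) 1
    simp only [map_add, map_smul, PiLp.add_apply, PiLp.smul_apply,
      apply_chartPoint_zero, apply_chartPoint_one, smul_eq_mul, mul_one, mul_zero, add_zero, h]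
    linarith

theorem inner_eq_coord (e : Plane ≃ₗᵢ[ℝ] Plane) (v w : Plane) :
    ⟪v, w⟫_ℝ = e v 0 * e w 0 + e v 1 * e w 1 := by
  rw [← e.inner_map_map, PiLp.inner_apply]
  simp [Fin.sum_univ_two, mul_comm]

theorem norm_sq_eq_coord (e : Plane ≃ₗᵢ[ℝ] Plane) (v : Plane) :
    ‖v‖ ^ 2 = e v 0 ^ 2 + e v 1 ^ 2 := by
  rw [← real_inner_self_eq_norm_sq, inner_eq_coord e]
  ring

/-- In a boundary chart the outward unit normal is the downward unit normal of the graph. -/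
theorem IsOutwardUnitNormal.eq_chartPoint {Ω : Set Plane} {x : Plane} {r : ℝ}
    {e : Plane ≃ₗᵢ[ℝ] Plane} {g : ℝ → ℝ} (hg : ContDiff ℝ 1 g)
    (hch : Ω ∩ Metric.ball x r = {y | g (e y 0) < e y 1} ∩ Metric.ball x r)
    {y ν : Plane} (hy : y ∈ Metric.ball x r) (hν : IsOutwardUnitNormal Ω y ν) :
    ν = chartPoint e (deriv g (e y 0) / √(1 + deriv g (e y 0) ^ 2),
      -1 / √(1 + deriv g (e y 0) ^ 2)) := by
  set d := deriv g (e y 0)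
  set N := chartPoint e (d / √(1 + d ^ 2), -1 / √(1 + d ^ 2)) with hN
  have hpos : 0 < √(1 + d ^ 2) := Real.sqrt_pos.mpr (by positivity)
  have hsq : √(1 + d ^ 2) ^ 2 = 1 + d ^ 2 := Real.sq_sqrt (by positivity)
  have hNN : ⟪N, N⟫_ℝ = 1 := by
    rw [inner_eq_coord e, hN, apply_chartPoint_zero, apply_chartPoint_one]
    field_simp
    rw [hsq]; ring
  have hN1 : ‖N‖ = 1 := by
    rw [real_inner_self_eq_norm_sq] at hNN
    nlinarith [norm_nonneg N]
  -- Two distinct unit vectors `N`, `ν` are separated by `v = N - ν`: it is obtuse to `ν` and acute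
  -- to `N`. So a short step along `v` enters `Ω` by the property of `ν`, yet falls below the graph
  -- because `N` is its downward normal.
  by_contra hne
  have hlt : ⟪N, ν⟫_ℝ < 1 := by
    rw [inner_lt_one_iff_real_of_norm_eq_one hN1 hν.norm_eq]
    exact fun h => hne h.symm
  have hνν : ⟪ν, ν⟫_ℝ = 1 := by rw [real_inner_self_eq_norm_sq, hν.norm_eq]; norm_num
  have hvν : ⟪N - ν, ν⟫_ℝ < 0 := by rw [inner_sub_left, hνν]; linarith
  have hvN : 0 < ⟪N - ν, N⟫_ℝ := by rw [inner_sub_left, hNN, real_inner_comm]; linarith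
  set v := N - ν with hv
  have hy0 : g (e y 0) = e y 1 := (mem_frontier_iff_of_chart hg.continuous hch hy).mp hν.mem_frontier
  have hline : Continuous fun t : ℝ => y + t • v := by fun_prop
  have hball : ∀ᶠ t in 𝓝[>] (0 : ℝ), y + t • v ∈ Metric.ball x r := by
    have h0 : Tendsto (fun t : ℝ => y + t • v) (𝓝[>] 0) (𝓝 y) := by
      have := hline.tendsto 0
      simp only [zero_smul, add_zero] at this
      exact this.mono_left nhdsWithin_le_nhds
    exact h0.eventually (Metric.isOpen_ball.mem_nhds hy)
  have hup : ∀ᶠ t in 𝓝[>] (0 : ℝ), 0 < (e y 1 + t * e v 1) - g (e y 0 + t * e v 0) := by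
    filter_upwards [hν.inner_neg v hvν, hball] with t ht htb
    have := (hch.subset ⟨ht, htb⟩).1
    simpa using this
  have hder : HasDerivAt (fun t : ℝ => (e y 1 + t * e v 1) - g (e y 0 + t * e v 0))
      (e v 1 - d * e v 0) 0 := by
    have h1 : HasDerivAt (fun t : ℝ => e y 1 + t * e v 1) (e v 1) 0 := by
      simpa using ((hasDerivAt_id (0 : ℝ)).mul_const (e v 1)).const_add (e y 1)
    have h0 : HasDerivAt (fun t : ℝ => e y 0 + t * e v 0) (e v 0) 0 := by
      simpa using ((hasDerivAt_id (0 : ℝ)).mul_const (e v 0)).const_add (e y 0)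
    have hgd : HasDerivAt g d (e y 0 + 0 * e v 0) := by
      rw [zero_mul, add_zero]
      exact (hg.differentiable one_ne_zero _).hasDerivAt
    exact h1.sub (hgd.comp (0 : ℝ) h0)
  have hneg : e v 1 - d * e v 0 < 0 := by
    have : ⟪v, N⟫_ℝ = -(e v 1 - d * e v 0) / √(1 + d ^ 2) := by
      rw [inner_eq_coord e, hN, apply_chartPoint_zero, apply_chartPoint_one]
      ring
    rw [this, div_pos_iff_of_pos_right hpos] at hvN
    linarith
  have hslope := hder.tendsto_slope_zero_right
  have hev := hslope.eventually (gt_mem_nhds hneg)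
  obtain ⟨t, h1, h2, h3⟩ := (hev.and (hup.and self_mem_nhdsWithin)).exists
  simp only [zero_add, zero_mul, add_zero, hy0, sub_self, sub_zero, smul_eq_mul] at h1
  have ht : (0 : ℝ) < t := h3
  have : 0 < t⁻¹ * (e y 1 + t * e v 1 - g (e y 0 + t * e v 0)) := by positivity
  linarith

/-! ### Arc length parametrizations -/

/-- At the breakpoints `γ` may jump from one boundary component to the next; elsewhere it agrees
locally with a unit speed `C³` curve. Finitely many exceptions do not affect the integrals. -/
theorem IsArcLengthParam.exists_finite {Ω : Set Plane} {L : ℝ} {γ : ℝ → Plane}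
    (hγ : IsArcLengthParam Ω L γ) :
    0 ≤ L ∧ ∃ Z : Set ℝ, Z.Finite ∧ ∀ s ∈ Set.Ioo 0 L \ Z,
      HasDerivAt γ (deriv γ s) s ∧ ‖deriv γ s‖ = 1 := by
  obtain ⟨m, t, hmono, h0, hL, hk⟩ := hγ.closed_curves
  refine ⟨by rw [← h0, ← hL]; exact hmono.monotone (Fin.zero_le _), Set.range t,
    Set.finite_range t, ?_⟩
  rintro s ⟨⟨hs0, hsL⟩, hsZ⟩
  -- The largest breakpoint not exceeding `s` identifies the interval containing `s`. It is not the
  -- last one, since `s < L`.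
  have hne : (Finset.univ.filter fun i : Fin (m + 1) => t i ≤ s).Nonempty :=
    ⟨0, by simp [h0, hs0.le]⟩
  obtain ⟨i, hi, hmax⟩ := Finset.exists_max_image _ id hne
  replace hi : t i ≤ s := by simpa using hi
  replace hmax : ∀ j, t j ≤ s → j ≤ i := fun j hj => hmax j (by simpa using hj)
  obtain ⟨k, rfl⟩ : ∃ k : Fin m, k.castSucc = i := by
    refine ⟨i.castPred ?_, Fin.castSucc_castPred _ _⟩
    rintro rfl
    linarith [hL ▸ hi]
  have h1 : t k.castSucc < s := lt_of_le_of_ne hi fun h => hsZ ⟨_, h⟩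
  have h2 : s < t k.succ := by
    by_contra! h
    exact absurd (hmax _ h) (not_le.mpr Fin.castSucc_lt_succ)
  obtain ⟨c, hc, -, hc1, hEq⟩ := hk k
  have hcd : HasDerivAt c (deriv c s) s := (hc.differentiable (by norm_num) s).hasDerivAt
  have hev : γ =ᶠ[𝓝 s] c := by
    filter_upwards [Ioo_mem_nhds h1 h2] with u hu using hEq ⟨hu.1.le, hu.2⟩
  have hd := hcd.congr_of_eventuallyEq hev
  rw [hd.deriv]
  exact ⟨hd, hc1 s⟩

/-- Integrals over a piece of the boundary that is a graph, in terms of the arc length. -/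
theorem integral_chart_eq_setIntegral_arcLength {Ω : Set Plane} {L : ℝ} {γ : ℝ → Plane}
    (hγ : IsArcLengthParam Ω L γ) {ν : ℝ → Plane}
    (hν : ∀ s ∈ Set.Ico 0 L, IsOutwardUnitNormal Ω (γ s) (ν s)) {x : Plane} {r : ℝ}
    {e : Plane ≃ₗᵢ[ℝ] Plane} {g : ℝ → ℝ} (hg : ContDiff ℝ 1 g)
    (hch : Ω ∩ Metric.ball x r = {y | g (e y 0) < e y 1} ∩ Metric.ball x r)
    {f : Plane → ℝ} (hf : ∀ y ∉ Metric.ball x r, f y = 0) (w : Plane) :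
    ∫ u, f (chartPoint e (u, g u)) * (e w 0 * deriv g u - e w 1) =
      ∫ s in Set.Ico 0 L, f (γ s) * ⟪w, ν s⟫_ℝ := by
  obtain ⟨hL, Z, hZ, hd⟩ := hγ.exists_finite
  -- The abscissa of `γ` in the chart serves as the change of variables `u = X s`, on the set `S` of
  -- regular parameters that `γ` sends into the ball.
  set X : ℝ → ℝ := fun s => e (γ s) 0 with hX
  set D : Set ℝ := Set.Ioo 0 L \ Z with hD
  set S : Set ℝ := D ∩ γ ⁻¹' Metric.ball x r with hS
  set V : Set ℝ := {u | chartPoint e (u, g u) ∈ Metric.ball x r} with hV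
  have hDm : MeasurableSet D := measurableSet_Ioo.diff hZ.measurableSet
  have hDo : IsOpen D := isOpen_Ioo.sdiff hZ.isClosed
  have hγc : ContinuousOn γ D := fun s hs => (hd s hs).1.continuousAt.continuousWithinAt
  have hSo : IsOpen S := hγc.isOpen_inter_preimage hDo Metric.isOpen_ball
  have hDI : D ⊆ Set.Ico 0 L := fun s hs => ⟨hs.1.1.le, hs.1.2⟩
  have hfr : ∀ s ∈ Set.Ico 0 L, γ s ∈ frontier Ω := fun s hs => by
    rw [← hγ.image_eq]; exact Set.mem_image_of_mem γ hs
  have hY : ∀ s ∈ Set.Ico 0 L, γ s ∈ Metric.ball x r → g (X s) = e (γ s) 1 := fun s hs hb =>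
    (mem_frontier_iff_of_chart hg.continuous hch hb).mp (hfr s hs)
  have hpt : ∀ s ∈ Set.Ico 0 L, γ s ∈ Metric.ball x r → chartPoint e (X s, g (X s)) = γ s := by
    intro s hs hb
    rw [hY s hs hb]
    exact chartPoint_apply_eq e (γ s)
  have heX : ∀ s ∈ D, ∀ i, HasDerivAt (fun s => e (γ s) i) (e (deriv γ s) i) s := by
    intro s hs i
    have h1 : HasDerivAt (fun s => e (γ s)) (e (deriv γ s)) s :=
      e.toContinuousLinearEquiv.hasFDerivAt.comp_hasDerivAt s (hd s hs).1
    exact (hasDerivAt_pi.mp ((PiLp.hasFDerivAt_ofLp 2 _).comp_hasDerivAt s h1) : _) i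
  have hXd : ∀ s ∈ S, HasDerivWithinAt X (e (deriv γ s) 0) S s := fun s hs =>
    (heX s hs.1 0).hasDerivWithinAt
  have hinj : Set.InjOn X S := by
    intro s hs s' hs' h
    refine hγ.injOn (hDI hs.1) (hDI hs'.1) ?_
    rw [← hpt s (hDI hs.1) hs.2, ← hpt s' (hDI hs'.1) hs'.2, h]
  have hrel : ∀ s ∈ S, e (deriv γ s) 1 = deriv g (X s) * e (deriv γ s) 0 := by
    intro s hs
    have h1 : HasDerivAt (fun s => g (X s)) (deriv g (X s) * e (deriv γ s) 0) s :=
      (hg.differentiable one_ne_zero _).hasDerivAt.comp s (heX s hs.1 0)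
    have hev : (fun s => e (γ s) 1) =ᶠ[𝓝 s] fun s => g (X s) := by
      filter_upwards [hSo.mem_nhds hs] with u hu using (hY u (hDI hu.1) hu.2).symm
    exact (heX s hs.1 1).unique (h1.congr_of_eventuallyEq hev)
  -- Unit speed reads `X'² + (g' X')² = 1`, which fixes the Jacobian; it is exactly the normalizing
  -- factor of the normal vector.
  have habs : ∀ s ∈ S, |e (deriv γ s) 0| = 1 / √(1 + deriv g (X s) ^ 2) := by
    intro s hs
    have h1 := norm_sq_eq_coord e (deriv γ s)
    rw [(hd s hs.1).2, hrel s hs] at h1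
    rw [← Real.sqrt_sq_eq_abs, one_div, ← Real.sqrt_inv]
    congr 1
    refine eq_inv_of_mul_eq_one_left ?_
    linarith
  have hintegrand : ∀ s ∈ S, |e (deriv γ s) 0| •
      (f (chartPoint e (X s, g (X s))) * (e w 0 * deriv g (X s) - e w 1)) =
      f (γ s) * ⟪w, ν s⟫_ℝ := by
    intro s hs
    rw [hpt s (hDI hs.1) hs.2, habs s hs, (hν s (hDI hs.1)).eq_chartPoint hg hch hs.2,
      inner_eq_coord e, apply_chartPoint_zero, apply_chartPoint_one, smul_eq_mul]
    ring
  have hR : ∫ s in Set.Ico 0 L, f (γ s) * ⟪w, ν s⟫_ℝ = ∫ s in S, f (γ s) * ⟪w, ν s⟫_ℝ := by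
    have h1 : (Set.Ico 0 L : Set ℝ) =ᵐ[volume] D := by
      refine Ico_ae_eq_Icc.trans (Ioo_ae_eq_Icc.symm.trans ?_)
      exact (sdiff_null_ae_eq_self (hZ.measure_zero volume)).symm
    rw [setIntegral_congr_set h1]
    refine setIntegral_eq_of_subset_of_forall_sdiff_eq_zero hDm
      (Set.inter_subset_left : S ⊆ D) ?_
    intro s hs
    have : γ s ∉ Metric.ball x r := fun h => hs.2 ⟨hs.1, h⟩
    rw [hf _ this, zero_mul]
  -- Since `γ` covers the whole frontier, the image of `S` can miss only the abscissas of the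
  -- breakpoints and of `γ 0`.
  have hVS : V =ᵐ[volume] X '' S := by
    have hsub : X '' S ⊆ V := by
      rintro _ ⟨s, hs, rfl⟩
      change chartPoint e (X s, g (X s)) ∈ Metric.ball x r
      rw [hpt s (hDI hs.1) hs.2]
      exact hs.2
    have hdiff : V \ X '' S ⊆ X '' (insert 0 Z) := by
      rintro u ⟨hu, huS⟩
      have hu' : chartPoint e (u, g u) ∈ frontier Ω := by
        rw [mem_frontier_iff_of_chart hg.continuous hch hu]
        simp
      rw [← hγ.image_eq] at hu'
      obtain ⟨s, hs, hsu⟩ := hu'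
      have hXs : X s = u := by rw [hX]; simp [hsu]
      refine ⟨s, ?_, hXs⟩
      by_contra hns
      rw [Set.mem_insert_iff, not_or] at hns
      refine huS ⟨s, ⟨⟨⟨lt_of_le_of_ne hs.1 (Ne.symm hns.1), hs.2⟩, hns.2⟩, ?_⟩, hXs⟩
      rw [Set.mem_preimage, hsu]
      exact hu
    have hnull : volume (V \ X '' S) = 0 :=
      measure_mono_null hdiff (((hZ.insert 0).image X).measure_zero volume)
    exact (ae_le_set.mpr hnull).antisymm hsub.eventuallyLE
  rw [hR, ← setIntegral_congr_fun hSo.measurableSet hintegrand,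
    ← integral_image_eq_integral_abs_deriv_smul hSo.measurableSet hXd hinj
      (fun u => f (chartPoint e (u, g u)) * (e w 0 * deriv g u - e w 1)),
    ← setIntegral_congr_set hVS]
  refine (setIntegral_eq_integral_of_forall_compl_eq_zero fun u hu => ?_).symm
  rw [hf _ hu, zero_mul]

/-! ### The divergence theorem on a bounded domain with regular boundary -/

theorem IsArcLengthParam.mem_frontier {Ω : Set Plane} {L : ℝ} {γ : ℝ → Plane}
    (hγ : IsArcLengthParam Ω L γ) {s : ℝ} (hs : s ∈ Set.Ico 0 L) : γ s ∈ frontier Ω := by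
  rw [← hγ.image_eq]
  exact Set.mem_image_of_mem γ hs

theorem aestronglyMeasurable_of_continuousOn_diff_finite {E : Type*} [TopologicalSpace E]
    [TopologicalSpace.PseudoMetrizableSpace E] [SecondCountableTopology E] {L : ℝ} {Z : Set ℝ}
    (hZ : Z.Finite) {f : ℝ → E} (hf : ContinuousOn f (Set.Ioo 0 L \ Z)) :
    AEStronglyMeasurable f (volume.restrict (Set.Ico 0 L)) := by
  borelize E
  have h1 : (Set.Ico 0 L : Set ℝ) =ᵐ[volume] (Set.Ioo 0 L \ Z : Set ℝ) := by
    refine Ico_ae_eq_Icc.trans (Ioo_ae_eq_Icc.symm.trans ?_)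
    exact (sdiff_null_ae_eq_self (hZ.measure_zero volume)).symm
  rw [Measure.restrict_congr_set h1]
  exact hf.aestronglyMeasurable (measurableSet_Ioo.diff hZ.measurableSet)

theorem IsArcLengthParam.aestronglyMeasurable {Ω : Set Plane} {L : ℝ} {γ : ℝ → Plane}
    (hγ : IsArcLengthParam Ω L γ) :
    AEStronglyMeasurable γ (volume.restrict (Set.Ico 0 L)) := by
  obtain ⟨-, Z, hZ, hd⟩ := hγ.exists_finite
  exact aestronglyMeasurable_of_continuousOn_diff_finite hZ fun s hs =>
    (hd s hs).1.continuousAt.continuousWithinAt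

/-- The normal is given only pointwise, but in a chart it equals a continuous function of `γ s`, so
it is continuous away from the breakpoints. -/
theorem aestronglyMeasurable_normal {Ω : Set Plane} (hΩ3 : HasC3Boundary Ω) {L : ℝ}
    {γ : ℝ → Plane} (hγ : IsArcLengthParam Ω L γ) {ν : ℝ → Plane}
    (hν : ∀ s ∈ Set.Ico 0 L, IsOutwardUnitNormal Ω (γ s) (ν s)) :
    AEStronglyMeasurable ν (volume.restrict (Set.Ico 0 L)) := by
  obtain ⟨-, Z, hZ, hd⟩ := hγ.exists_finite
  refine aestronglyMeasurable_of_continuousOn_diff_finite hZ fun s hs => ?_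
  have hsI : s ∈ Set.Ico 0 L := ⟨hs.1.1.le, hs.1.2⟩
  obtain ⟨r, hr, e, g, hg, hch⟩ := hΩ3 _ (hγ.mem_frontier hsI)
  have hg1 : ContDiff ℝ 1 g := hg.of_le (by norm_num)
  have hγs : ContinuousAt γ s := (hd s hs).1.continuousAt
  have hDo : IsOpen (Set.Ioo 0 L \ Z) := isOpen_Ioo.sdiff hZ.isClosed
  have hev : ν =ᶠ[𝓝 s] fun s' => chartPoint e
      (deriv g (e (γ s') 0) / √(1 + deriv g (e (γ s') 0) ^ 2),
        -1 / √(1 + deriv g (e (γ s') 0) ^ 2)) := by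
    filter_upwards [hDo.mem_nhds hs, hγs (Metric.isOpen_ball.mem_nhds (Metric.mem_ball_self hr))]
      with s' hs' hb
    exact (hν s' ⟨hs'.1.1.le, hs'.1.2⟩).eq_chartPoint hg1 hch hb
  have hgc : Continuous (deriv g) := hg1.continuous_deriv le_rfl
  have hcont : Continuous fun y : Plane => chartPoint e
      (deriv g (e y 0) / √(1 + deriv g (e y 0) ^ 2), -1 / √(1 + deriv g (e y 0) ^ 2)) := by
    refine (chartPoint e).continuous.comp (Continuous.prodMk ?_ ?_)
    · refine Continuous.div (by fun_prop) (by fun_prop) fun y => ?_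
      exact (Real.sqrt_pos.mpr (by positivity)).ne'
    · refine Continuous.div (by fun_prop) (by fun_prop) fun y => ?_
      exact (Real.sqrt_pos.mpr (by positivity)).ne'
  exact ((hcont.continuousAt.comp hγs).congr hev.symm).continuousWithinAt

theorem integrableOn_boundary {Ω : Set Plane} (hΩb : Bornology.IsBounded Ω)
    (hΩ3 : HasC3Boundary Ω) {L : ℝ}
    {γ : ℝ → Plane} (hγ : IsArcLengthParam Ω L γ) {ν : ℝ → Plane}
    (hν : ∀ s ∈ Set.Ico 0 L, IsOutwardUnitNormal Ω (γ s) (ν s)) {f : Plane → ℝ}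
    (hf : Continuous f) (w : Plane) :
    IntegrableOn (fun s => f (γ s) * ⟪w, ν s⟫_ℝ) (Set.Ico 0 L) := by
  have hK : IsCompact (frontier Ω) :=
    hΩb.isCompact_closure.of_isClosed_subset isClosed_frontier frontier_subset_closure
  obtain ⟨C, hC⟩ := hK.exists_bound_of_continuousOn hf.continuousOn
  refine Integrable.of_bound ?_ (C * ‖w‖) ?_
  · exact (hf.comp_aestronglyMeasurable hγ.aestronglyMeasurable).mul
      (aestronglyMeasurable_const.inner (aestronglyMeasurable_normal hΩ3 hγ hν))
  · filter_upwards [ae_restrict_mem measurableSet_Ico] with s hs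
    rw [norm_mul]
    have h1 := hC _ (hγ.mem_frontier hs)
    have h2 : ‖⟪w, ν s⟫_ℝ‖ ≤ ‖w‖ := by
      have := norm_inner_le_norm (𝕜 := ℝ) w (ν s)
      rwa [(hν s hs).norm_eq, mul_one] at this
    exact mul_le_mul h1 h2 (norm_nonneg _) ((norm_nonneg _).trans h1)

theorem integral_fderiv_eq_zero {f : Plane → ℝ} (hf : ContDiff ℝ 1 f) (hc : HasCompactSupport f)
    (w : Plane) : ∫ y, fderiv ℝ f y w = 0 := by
  have hi : Integrable fun y => fderiv ℝ f y w :=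
    ((hf.continuous_fderiv one_ne_zero).clm_apply continuous_const).integrable_of_hasCompactSupport
      (hc.fderiv_apply (𝕜 := ℝ) w)
  -- Integration by parts against the constant function `1`.
  have := integral_mul_fderiv_eq_neg_fderiv_mul_of_integrable (μ := (volume : Measure Plane))
    (f := fun _ => (1 : ℝ)) (g := f) (v := w) (by simp) (by simpa using hi)
    (by simpa using hf.continuous.integrable_of_hasCompactSupport hc)
    (fun y _ => differentiableAt_const _) (fun y _ => hf.differentiable one_ne_zero y)
  simpa using this

/-- Cutting off at the frontier creates no jump because `f` vanishes near every frontier point. -/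
theorem contDiff_indicator_of_disjoint_frontier {Ω : Set Plane} (hΩ : IsOpen Ω) {f : Plane → ℝ}
    (hf : ContDiff ℝ 1 f) (hd : Disjoint (tsupport f) (frontier Ω)) :
    ContDiff ℝ 1 (Ω.indicator f) ∧
      ∀ y, fderiv ℝ (Ω.indicator f) y = Ω.indicator (fderiv ℝ f) y := by
  have hloc : ∀ y, (y ∈ Ω ∧ Ω.indicator f =ᶠ[𝓝 y] f) ∨
      (Ω.indicator f =ᶠ[𝓝 y] 0 ∧ Ω.indicator (fderiv ℝ f) y = 0) := by
    intro y
    by_cases hy : y ∈ Ω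
    · left
      refine ⟨hy, ?_⟩
      filter_upwards [hΩ.mem_nhds hy] with z hz using Set.indicator_of_mem hz f
    · right
      refine ⟨?_, Set.indicator_of_notMem hy _⟩
      by_cases hcl : y ∈ closure Ω
      · have hfr : y ∈ frontier Ω := by
          rw [hΩ.frontier_eq]
          exact ⟨hcl, hy⟩
        have hns : y ∉ tsupport f := fun h => Set.disjoint_left.mp hd h hfr
        filter_upwards [(isClosed_tsupport f).isOpen_compl.mem_nhds hns] with z hz
        simp [image_eq_zero_of_notMem_tsupport hz]
      · filter_upwards [isClosed_closure.isOpen_compl.mem_nhds hcl] with z hz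
        exact Set.indicator_of_notMem (fun h => hz (subset_closure h)) f
  refine ⟨contDiff_iff_contDiffAt.mpr fun y => ?_, fun y => ?_⟩
  · rcases hloc y with ⟨-, h⟩ | ⟨h, -⟩
    · exact hf.contDiffAt.congr_of_eventuallyEq h
    · exact contDiffAt_const.congr_of_eventuallyEq h
  · rcases hloc y with ⟨hy, h⟩ | ⟨h, h0⟩
    · rw [h.fderiv_eq, Set.indicator_of_mem hy]
    · rw [h.fderiv_eq, h0]
      simp

/-- Both sides vanish: the cut-off function is `C¹` with compact support on the whole plane, and `f`
is zero along `γ`. -/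
theorem setIntegral_fderiv_of_disjoint_frontier {Ω : Set Plane} (hΩ : IsOpen Ω) {L : ℝ}
    {γ : ℝ → Plane} (hγ : IsArcLengthParam Ω L γ) (ν : ℝ → Plane) {f : Plane → ℝ}
    (hf : ContDiff ℝ 1 f) (hc : HasCompactSupport f)
    (hd : Disjoint (tsupport f) (frontier Ω)) (w : Plane) :
    ∫ y in Ω, fderiv ℝ f y w = ∫ s in Set.Ico 0 L, f (γ s) * ⟪w, ν s⟫_ℝ := by
  obtain ⟨h1, h2⟩ := contDiff_indicator_of_disjoint_frontier hΩ hf hd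
  have hci : HasCompactSupport (Ω.indicator f) :=
    hc.mono fun y hy h => hy (by simp [h])
  have h3 := integral_fderiv_eq_zero h1 hci w
  have hl : ∫ y in Ω, fderiv ℝ f y w = 0 := by
    rw [← h3, ← integral_indicator hΩ.measurableSet]
    congr 1
    ext y
    rw [h2]
    by_cases hy : y ∈ Ω <;> simp [hy]
  rw [hl, eq_comm]
  refine setIntegral_eq_zero_of_forall_eq_zero fun s hs => ?_
  rw [image_eq_zero_of_notMem_tsupport fun h => Set.disjoint_left.mp hd h (hγ.mem_frontier hs),
    zero_mul]

theorem setIntegral_fderiv_of_tsupport_subset_ball {Ω : Set Plane} (hΩ : IsOpen Ω) {L : ℝ}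
    {γ : ℝ → Plane} (hγ : IsArcLengthParam Ω L γ) {ν : ℝ → Plane}
    (hν : ∀ s ∈ Set.Ico 0 L, IsOutwardUnitNormal Ω (γ s) (ν s)) {x : Plane} {r : ℝ}
    {e : Plane ≃ₗᵢ[ℝ] Plane} {g : ℝ → ℝ} (hg : ContDiff ℝ 1 g)
    (hch : Ω ∩ Metric.ball x r = {y | g (e y 0) < e y 1} ∩ Metric.ball x r)
    {f : Plane → ℝ} (hf : ContDiff ℝ 1 f) (hc : HasCompactSupport f)
    (hs : tsupport f ⊆ Metric.ball x r) (w : Plane) :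
    ∫ y in Ω, fderiv ℝ f y w = ∫ s in Set.Ico 0 L, f (γ s) * ⟪w, ν s⟫_ℝ := by
  rw [← integral_chart_eq_setIntegral_arcLength hγ hν hg hch
    (fun y hy => image_eq_zero_of_notMem_tsupport fun h => hy (hs h)) w,
    ← setIntegral_chart_fderiv hf hc hg e w]
  have hU : IsOpen {y : Plane | g (e y 0) < e y 1} :=
    isOpen_lt (hg.continuous.comp (by fun_prop)) (by fun_prop)
  have hz : ∀ y ∉ Metric.ball x r, fderiv ℝ f y w = 0 := by
    intro y hy
    rw [image_eq_zero_of_notMem_tsupport fun h => hy (hs (tsupport_fderiv_subset ℝ h))]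
    rfl
  have hA : ∀ A : Set Plane, MeasurableSet A →
      ∫ y in A, fderiv ℝ f y w = ∫ y in A ∩ Metric.ball x r, fderiv ℝ f y w := fun A hA =>
    setIntegral_eq_of_subset_of_forall_sdiff_eq_zero hA Set.inter_subset_left
      fun y hy => hz y fun h => hy.2 ⟨hy.1, h⟩
  rw [hA _ hΩ.measurableSet, hA _ hU.measurableSet, hch]

/-- Induction on the number of balls that cover the part of the frontier met by the support. A bump
`χ` peels off one ball: `χ f` lives in a single chart, and `(1 - χ) f` needs one ball fewer. -/
theorem setIntegral_fderiv_of_hasCompactSupport {Ω : Set Plane} (hΩ : IsOpen Ω)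
    (hΩb : Bornology.IsBounded Ω) (hΩ3 : HasC3Boundary Ω) {L : ℝ}
    {γ : ℝ → Plane} (hγ : IsArcLengthParam Ω L γ) {ν : ℝ → Plane}
    (hν : ∀ s ∈ Set.Ico 0 L, IsOutwardUnitNormal Ω (γ s) (ν s))
    {f : Plane → ℝ} (hf : ContDiff ℝ 1 f) (hc : HasCompactSupport f) (w : Plane) :
    ∫ y in Ω, fderiv ℝ f y w = ∫ s in Set.Ico 0 L, f (γ s) * ⟪w, ν s⟫_ℝ := by
  classical
  choose! r hr e g hg hch using hΩ3
  have hK : IsCompact (frontier Ω) :=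
    hΩb.isCompact_closure.of_isClosed_subset isClosed_frontier frontier_subset_closure
  obtain ⟨T, hT, hcov⟩ := hK.elim_nhds_subcover (fun x => Metric.ball x (r x / 2))
    fun x hx => Metric.ball_mem_nhds x (half_pos (hr x hx))
  have main : ∀ T : Finset Plane, (∀ x ∈ T, x ∈ frontier Ω) → ∀ f : Plane → ℝ, ContDiff ℝ 1 f →
      HasCompactSupport f → tsupport f ∩ frontier Ω ⊆ ⋃ x ∈ T, Metric.ball x (r x / 2) →
      ∫ y in Ω, fderiv ℝ f y w = ∫ s in Set.Ico 0 L, f (γ s) * ⟪w, ν s⟫_ℝ := by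
    intro T
    induction T using Finset.induction_on with
    | empty =>
      intro _ f hf hc hsub
      refine setIntegral_fderiv_of_disjoint_frontier hΩ hγ ν hf hc ?_ w
      rw [Set.disjoint_iff_inter_eq_empty]
      exact Set.subset_eq_empty hsub (by simp)
    | insert x T hxT ih =>
      intro hTm f hf hc hsub
      have hx : x ∈ frontier Ω := hTm x (Finset.mem_insert_self x T)
      have hrx := hr x hx
      -- Equal to `1` on the half ball used in the cover, and supported strictly inside the chart
      -- ball.
      let χ : ContDiffBump x := ⟨r x / 2, 3 * r x / 4, by positivity, by linarith⟩
      have hχ : ContDiff ℝ 1 χ := χ.contDiff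
      have hf1 : ContDiff ℝ 1 fun y => χ y * f y := hχ.mul hf
      have hf2 : ContDiff ℝ 1 fun y => (1 - χ y) * f y := (contDiff_const.sub hχ).mul hf
      have hc1 : HasCompactSupport fun y => χ y * f y := hc.mul_left
      have hc2 : HasCompactSupport fun y => (1 - χ y) * f y := hc.mul_left
      have e1 := setIntegral_fderiv_of_tsupport_subset_ball hΩ hγ hν
        ((hg x hx).of_le (by norm_num)) (hch x hx) hf1 hc1
        ((tsupport_mul_subset_left).trans (by
          rw [χ.tsupport_eq]
          exact Metric.closedBall_subset_ball (show 3 * r x / 4 < r x by linarith))) w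
      have e2 := ih (fun z hz => hTm z (Finset.mem_insert_of_mem hz)) _ hf2 hc2 (by
        rintro y ⟨hy, hyf⟩
        have hyf' : y ∈ tsupport f := tsupport_mul_subset_right hy
        have hnb : y ∉ Metric.ball x (r x / 2) := by
          intro hb
          refine notMem_tsupport_iff_eventuallyEq.mpr ?_ hy
          filter_upwards [Metric.isOpen_ball.mem_nhds hb] with z hz
          rw [χ.one_of_mem_closedBall (Metric.ball_subset_closedBall hz)]
          simp
        have := hsub ⟨hyf', hyf⟩
        rw [Finset.set_biUnion_insert] at this
        exact this.resolve_left hnb)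
      have hint : ∀ h : Plane → ℝ, ContDiff ℝ 1 h → HasCompactSupport h →
          IntegrableOn (fun y => fderiv ℝ h y w) Ω := fun h hh hhc =>
        (((hh.continuous_fderiv one_ne_zero).clm_apply
          continuous_const).integrable_of_hasCompactSupport
            (hhc.fderiv_apply (𝕜 := ℝ) w)).integrableOn
      have hsum : f = fun y => χ y * f y + (1 - χ y) * f y := by ext y; ring
      have hL : ∫ y in Ω, fderiv ℝ f y w = (∫ y in Ω, fderiv ℝ (fun y => χ y * f y) y w) +
          ∫ y in Ω, fderiv ℝ (fun y => (1 - χ y) * f y) y w := by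
        rw [← integral_add (hint _ hf1 hc1) (hint _ hf2 hc2)]
        congr 1
        ext y
        conv_lhs => rw [hsum]
        rw [fderiv_fun_add (hf1.differentiable one_ne_zero y) (hf2.differentiable one_ne_zero y)]
        rfl
      rw [hL, e1, e2, ← integral_add
        (integrableOn_boundary hΩb (fun x hx => ⟨r x, hr x hx, e x, g x, hg x hx, hch x hx⟩)
          hγ hν hf1.continuous w)
        (integrableOn_boundary hΩb (fun x hx => ⟨r x, hr x hx, e x, g x, hg x hx, hch x hx⟩)
          hγ hν hf2.continuous w)]
      congr 1
      ext s
      ring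
  exact main T hT f hf hc (Set.inter_subset_right.trans hcov)

/-- The divergence theorem on `Ω`, for a field `f • w` of constant direction. -/
theorem setIntegral_fderiv_eq_boundary {Ω : Set Plane} (hΩ : IsOpen Ω)
    (hΩb : Bornology.IsBounded Ω) (hΩ3 : HasC3Boundary Ω) {L : ℝ}
    {γ : ℝ → Plane} (hγ : IsArcLengthParam Ω L γ) {ν : ℝ → Plane}
    (hν : ∀ s ∈ Set.Ico 0 L, IsOutwardUnitNormal Ω (γ s) (ν s))
    {f : Plane → ℝ} (hf : ContDiff ℝ 1 f) (w : Plane) :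
    ∫ y in Ω, fderiv ℝ f y w = ∫ s in Set.Ico 0 L, f (γ s) * ⟪w, ν s⟫_ℝ := by
  obtain ⟨R, hR⟩ := hΩb.closure.subset_ball (0 : Plane)
  -- A cutoff equal to `1` near `closure Ω` removes the compact support assumption; `max R 1` keeps
  -- the radius positive.
  let χ : ContDiffBump (0 : Plane) := ⟨max R 1, max R 1 + 1, by positivity, by linarith⟩
  have hχ : ContDiff ℝ 1 χ := χ.contDiff
  have hone : ∀ y ∈ closure Ω, χ =ᶠ[𝓝 y] 1 := by
    intro y hy
    filter_upwards [Metric.isOpen_ball.mem_nhds (hR hy)] with z hz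
    exact χ.one_of_mem_closedBall
      (Metric.closedBall_subset_closedBall (le_max_left _ _) (Metric.ball_subset_closedBall hz))
  have key := setIntegral_fderiv_of_hasCompactSupport hΩ hΩb hΩ3 hγ hν (hχ.mul hf)
    χ.hasCompactSupport.mul_right w
  rw [setIntegral_congr_fun (g := fun y => fderiv ℝ f y w) hΩ.measurableSet,
    setIntegral_congr_fun (g := fun s => f (γ s) * ⟪w, ν s⟫_ℝ) measurableSet_Ico] at key
  · exact key
  · intro s hs
    have := (hone _ (frontier_subset_closure (hγ.mem_frontier hs))).self_of_nhds
    simp [this]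
  · intro y hy
    have : (fun y => χ y * f y) =ᶠ[𝓝 y] f := by
      filter_upwards [hone _ (subset_closure hy)] with z hz
      simp [hz]
    simp only [this.fderiv_eq]

/-! ### Real bilinear forms on spinors and the trace inequality -/

theorem norm_matAct_apply_le (A : Matrix (Fin 2) (Fin 2) ℂ) (v : Spinor) :
    ‖matAct A v‖ ≤ ‖matAct A‖ * ‖v‖ := (matAct A).le_opNorm v

/-- The real bilinear form `(v, w) ↦ Re ⟨v, A w⟩`. -/
noncomputable def reForm (A : Matrix (Fin 2) (Fin 2) ℂ) : Spinor →L[ℝ] Spinor →L[ℝ] ℝ :=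
  LinearMap.mkContinuous₂
    (LinearMap.mk₂ ℝ (fun v w => (inner ℂ v (matAct A w)).re)
      (fun v v' w => by rw [inner_add_left, Complex.add_re])
      (fun c v w => by
        rw [← Complex.coe_smul, inner_smul_left, Complex.conj_ofReal, Complex.re_ofReal_mul,
          smul_eq_mul])
      (fun v w w' => by rw [map_add, inner_add_right, Complex.add_re])
      (fun c v w => by
        rw [← Complex.coe_smul, map_smul, inner_smul_right, Complex.re_ofReal_mul, smul_eq_mul]))
    ‖matAct A‖ (fun v w => by
      rw [LinearMap.mk₂_apply]
      refine (Complex.abs_re_le_norm _).trans ((norm_inner_le_norm _ _).trans ?_)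
      have := mul_le_mul_of_nonneg_left (norm_matAct_apply_le A w) (norm_nonneg v)
      linarith)

theorem reForm_apply (A : Matrix (Fin 2) (Fin 2) ℂ) (v w : Spinor) :
    reForm A v w = (inner ℂ v (matAct A w)).re := rfl

theorem matAct_one_apply (v : Spinor) : matAct 1 v = v := by
  simp [matAct]

theorem reForm_one_self (v : Spinor) : reForm 1 v v = ‖v‖ ^ 2 := by
  rw [reForm_apply, matAct_one_apply]
  exact inner_self_eq_norm_sq (𝕜 := ℂ) v

theorem contDiff_bilinear_self (B : Spinor →L[ℝ] Spinor →L[ℝ] ℝ) (φ : 𝓢(Plane, Spinor)) :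
    ContDiff ℝ 1 fun y => B (φ y) (φ y) :=
  (B.contDiff.comp (φ.smooth 1)).clm_apply (φ.smooth 1)

theorem fderiv_bilinear_self (B : Spinor →L[ℝ] Spinor →L[ℝ] ℝ) (φ : 𝓢(Plane, Spinor))
    (w y : Plane) :
    fderiv ℝ (fun y => B (φ y) (φ y)) y w = B (φ y) (∂_{w} φ y) + B (∂_{w} φ y) (φ y) := by
  have h := B.hasFDerivAt_of_bilinear (φ.hasFDerivAt y) (φ.hasFDerivAt y)
  rw [h.fderiv]
  simp [SchwartzMap.lineDerivOp_apply_eq_fderiv]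

theorem integrable_norm_sq (φ : 𝓢(Plane, Spinor)) : Integrable fun y => ‖φ y‖ ^ 2 :=
  (φ.memLp 2 volume).integrable_norm_pow two_ne_zero

theorem integral_norm_sq_eq_norm_toLp {E F : Type*} [NormedAddCommGroup F] [MeasurableSpace E]
    {μ : Measure E} {f : E → F} (hf : MemLp f 2 μ) :
    ∫ y, ‖f y‖ ^ 2 ∂μ = ‖hf.toLp f‖ ^ 2 := by
  rw [Lp.norm_toLp, hf.eLpNorm_eq_integral_rpow_norm two_ne_zero ENNReal.ofNat_ne_top,
    ENNReal.toReal_ofReal (by positivity)]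
  simp only [ENNReal.toReal_ofNat, Real.rpow_ofNat]
  rw [← Real.rpow_natCast, ← Real.rpow_mul (by positivity)]
  norm_num

theorem lineDerivOp_eq_coord (φ : 𝓢(Plane, Spinor)) (w y : Plane) :
    ∂_{w} φ y = w 0 • ∂_{planeBasis 0} φ y + w 1 • ∂_{planeBasis 1} φ y := by
  simp only [SchwartzMap.lineDerivOp_apply_eq_fderiv]
  rw [← map_smul, ← map_smul, ← map_add]
  congr 1
  ext i
  fin_cases i <;> simp [planeBasis]

/-- The squared `H¹` norm of a Schwartz function. -/
noncomputable def sobolevEnergy (φ : 𝓢(Plane, Spinor)) : ℝ :=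
  ∫ y, (‖φ y‖ ^ 2 + ∑ j : Fin 2, ‖∂_{planeBasis j} φ y‖ ^ 2)

theorem integrable_sobolevEnergy (φ : 𝓢(Plane, Spinor)) :
    Integrable fun y => ‖φ y‖ ^ 2 + ∑ j : Fin 2, ‖∂_{planeBasis j} φ y‖ ^ 2 :=
  (integrable_norm_sq φ).add (integrable_finsetSum _ fun _ _ => integrable_norm_sq _)

theorem norm_sq_lineDerivOp_le (φ : 𝓢(Plane, Spinor)) (w y : Plane) (hw : ‖w‖ ≤ 1) :
    ‖∂_{w} φ y‖ ^ 2 ≤ 2 * ∑ j : Fin 2, ‖∂_{planeBasis j} φ y‖ ^ 2 := by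
  have h0 : ‖w 0‖ ≤ 1 := (PiLp.norm_apply_le w 0).trans hw
  have h1 : ‖w 1‖ ≤ 1 := (PiLp.norm_apply_le w 1).trans hw
  have h : ‖∂_{w} φ y‖ ≤ ‖∂_{planeBasis 0} φ y‖ + ‖∂_{planeBasis 1} φ y‖ := by
    rw [lineDerivOp_eq_coord]
    refine (norm_add_le _ _).trans (add_le_add ?_ ?_) <;> rw [norm_smul]
    · exact mul_le_of_le_one_left (norm_nonneg _) h0
    · exact mul_le_of_le_one_left (norm_nonneg _) h1
  rw [Fin.sum_univ_two]
  nlinarith [norm_nonneg (∂_{w} φ y), sq_nonneg (‖∂_{planeBasis 0} φ y‖ - ‖∂_{planeBasis 1} φ y‖)]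

theorem integrableOn_indicator_boundary {Ω : Set Plane} (hΩb : Bornology.IsBounded Ω) {L : ℝ}
    {γ : ℝ → Plane} (hγ : IsArcLengthParam Ω L γ) {S : Set Plane} (hS : MeasurableSet S)
    {F : Plane → ℝ} (hF : Continuous F) :
    IntegrableOn (fun s => S.indicator F (γ s)) (Set.Ico 0 L) := by
  have hK : IsCompact (frontier Ω) :=
    hΩb.isCompact_closure.of_isClosed_subset isClosed_frontier frontier_subset_closure
  obtain ⟨C, hC⟩ := hK.exists_bound_of_continuousOn hF.continuousOn
  refine Integrable.of_bound ?_ C ?_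
  · exact ((hF.measurable.indicator hS).comp_aemeasurable
      hγ.aestronglyMeasurable.aemeasurable).aestronglyMeasurable
  · filter_upwards [ae_restrict_mem measurableSet_Ico] with s hs
    exact (norm_indicator_le_norm_self _ _).trans (hC _ (hγ.mem_frontier hs))

theorem abs_fderiv_bump_mul_norm_sq_le {x : Plane} (χ : ContDiffBump x) {w : Plane} (hw : ‖w‖ ≤ 1) :
    ∃ C : ℝ, 0 ≤ C ∧ ∀ (φ : 𝓢(Plane, Spinor)) (y : Plane),
      |fderiv ℝ (fun y => χ y * reForm 1 (φ y) (φ y)) y w| ≤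
        C * (‖φ y‖ ^ 2 + ∑ j : Fin 2, ‖∂_{planeBasis j} φ y‖ ^ 2) := by
  have hχ : ContDiff ℝ 1 χ := χ.contDiff
  obtain ⟨C, hC⟩ := (χ.hasCompactSupport.fderiv (𝕜 := ℝ)).exists_bound_of_continuous
    (hχ.continuous_fderiv one_ne_zero)
  have hC0 : 0 ≤ C := (norm_nonneg _).trans (hC x)
  -- `C` bounds the derivative of the cutoff. The `2` comes from `norm_sq_lineDerivOp_le`, after
  -- `2ab ≤ a² + b²` for the term where `φ` is differentiated.
  refine ⟨C + 2, by linarith, fun φ y => ?_⟩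
  have hd := ((hχ.differentiable one_ne_zero y).hasFDerivAt.mul
    ((contDiff_bilinear_self (reForm 1) φ).differentiable one_ne_zero y).hasFDerivAt).fderiv
  have hsymm : ∀ v v' : Spinor, reForm 1 v v' = reForm 1 v' v := fun v v' => by
    rw [reForm_apply, reForm_apply, matAct_one_apply, matAct_one_apply, ← inner_conj_symm,
      Complex.conj_re]
  have hCS : ∀ v v' : Spinor, |reForm 1 v v'| ≤ ‖v‖ * ‖v'‖ := fun v v' => by
    rw [reForm_apply, matAct_one_apply]
    exact (Complex.abs_re_le_norm _).trans (norm_inner_le_norm _ _)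
  have hform : fderiv ℝ (fun y => χ y * reForm 1 (φ y) (φ y)) y w =
      χ y * (2 * reForm 1 (φ y) (∂_{w} φ y)) + ‖φ y‖ ^ 2 * fderiv ℝ χ y w := by
    have h2 := fderiv_bilinear_self (reForm 1) φ w y
    rw [hsymm (∂_{w} φ y), ← two_mul] at h2
    refine (DFunLike.congr_fun hd w).trans ?_
    rw [_root_.add_apply, _root_.smul_apply, _root_.smul_apply, smul_eq_mul, smul_eq_mul, h2,
      reForm_one_self]
  have hb1 : |χ y * (2 * reForm 1 (φ y) (∂_{w} φ y))| ≤ ‖φ y‖ ^ 2 + ‖∂_{w} φ y‖ ^ 2 := by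
    rw [abs_mul, abs_of_nonneg χ.nonneg, abs_mul, abs_two]
    have h1 := hCS (φ y) (∂_{w} φ y)
    have h3 : χ y * (2 * |reForm 1 (φ y) (∂_{w} φ y)|) ≤
        1 * (2 * |reForm 1 (φ y) (∂_{w} φ y)|) :=
      mul_le_mul_of_nonneg_right χ.le_one (by positivity)
    nlinarith [sq_nonneg (‖φ y‖ - ‖∂_{w} φ y‖)]
  have hb2 : |‖φ y‖ ^ 2 * fderiv ℝ χ y w| ≤ C * ‖φ y‖ ^ 2 := by
    rw [abs_mul, abs_of_nonneg (by positivity), mul_comm]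
    refine mul_le_mul_of_nonneg_right ?_ (by positivity)
    refine ((fderiv ℝ χ y).le_opNorm w).trans ?_
    calc _ ≤ C * 1 := mul_le_mul (hC y) hw (norm_nonneg _) hC0
      _ = C := mul_one C
  have hb3 := norm_sq_lineDerivOp_le φ w y hw
  have hS : 0 ≤ ∑ j : Fin 2, ‖∂_{planeBasis j} φ y‖ ^ 2 := by positivity
  rw [hform]
  refine (abs_add_le _ _).trans ?_
  nlinarith [mul_nonneg hC0 hS, sq_nonneg ‖φ y‖]

/-- The divergence theorem is applied to `χ |φ|² w`, where `w` is the downward chart direction.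
Since `w` is uniformly transversal to the boundary near `x`, the flux dominates the boundary
integral, while the volume integral is bounded by the `H¹` energy. -/
theorem exists_local_trace_bound {Ω : Set Plane} (hΩ : IsOpen Ω)
    (hΩb : Bornology.IsBounded Ω) (hΩ3 : HasC3Boundary Ω) {L : ℝ}
    {γ : ℝ → Plane} (hγ : IsArcLengthParam Ω L γ) {ν : ℝ → Plane}
    (hν : ∀ s ∈ Set.Ico 0 L, IsOutwardUnitNormal Ω (γ s) (ν s))
    {x : Plane} (hx : x ∈ frontier Ω) :
    ∃ ρ > 0, ∃ C : ℝ, ∀ φ : 𝓢(Plane, Spinor),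
      ∫ s in Set.Ico 0 L, (Metric.ball x ρ).indicator (fun y => ‖φ y‖ ^ 2) (γ s) ≤
        C * sobolevEnergy φ := by
  obtain ⟨r, hr, e, g, hg, hch⟩ := hΩ3 x hx
  have hg1 : ContDiff ℝ 1 g := hg.of_le (by norm_num)
  have hgc : Continuous fun y : Plane => |deriv g (e y 0)| :=
    ((hg1.continuous_deriv le_rfl).comp (by fun_prop)).abs
  -- A slope bound valid near `x`; it yields `⟪w, ν⟫ ≥ 1 / √(1 + K²)` there.
  set K := |deriv g (e x 0)| + 1 with hK
  obtain ⟨δ, hδ, hδK⟩ : ∃ δ > 0, ∀ y ∈ Metric.ball x δ, |deriv g (e y 0)| < K := by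
    have := hgc.continuousAt.eventually (gt_mem_nhds (show |deriv g (e x 0)| < K by simp [hK]))
    exact Metric.eventually_nhds_iff_ball.mp this
  set ρ := min δ r with hρ
  have hρ0 : 0 < ρ := lt_min hδ hr
  let χ : ContDiffBump x := ⟨ρ / 2, 3 * ρ / 4, by positivity, by linarith⟩
  set w : Plane := -chartPoint e (0, 1) with hw
  have hw0 : e w 0 = 0 := by rw [hw, map_neg, PiLp.neg_apply, apply_chartPoint_zero, neg_zero]
  have hw1 : e w 1 = -1 := by rw [hw, map_neg, PiLp.neg_apply, apply_chartPoint_one]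
  have hwn : ‖w‖ ≤ 1 := by
    have := norm_sq_eq_coord e w
    rw [hw0, hw1] at this
    nlinarith [norm_nonneg w]
  obtain ⟨C, hC0, hC⟩ := abs_fderiv_bump_mul_norm_sq_le χ hwn
  have hc : 0 < √(1 + K ^ 2) := Real.sqrt_pos.mpr (by positivity)
  refine ⟨ρ / 2, half_pos hρ0, √(1 + K ^ 2) * C, fun φ => ?_⟩
  have hχ : ContDiff ℝ 1 χ := χ.contDiff
  have hf : ContDiff ℝ 1 fun y => χ y * reForm 1 (φ y) (φ y) :=
    hχ.mul (contDiff_bilinear_self (reForm 1) φ)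
  have hdiv := setIntegral_fderiv_eq_boundary hΩ hΩb hΩ3 hγ hν hf w
  have hup : ∫ y in Ω, fderiv ℝ (fun y => χ y * reForm 1 (φ y) (φ y)) y w ≤
      C * sobolevEnergy φ := by
    have hi := (integrable_sobolevEnergy φ).const_mul C
    have hfi : Integrable fun y => fderiv ℝ (fun y => χ y * reForm 1 (φ y) (φ y)) y w :=
      hi.mono' ((hf.continuous_fderiv one_ne_zero).clm_apply
        continuous_const).aestronglyMeasurable (Eventually.of_forall (hC φ))
    calc _ ≤ ∫ y in Ω, C * (‖φ y‖ ^ 2 + ∑ j : Fin 2, ‖∂_{planeBasis j} φ y‖ ^ 2) :=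
          integral_mono hfi.integrableOn hi.integrableOn
            fun y => (le_abs_self _).trans (hC φ y)
      _ ≤ ∫ y, C * (‖φ y‖ ^ 2 + ∑ j : Fin 2, ‖∂_{planeBasis j} φ y‖ ^ 2) :=
          setIntegral_le_integral hi (Eventually.of_forall fun y => by
            change 0 ≤ C * (‖φ y‖ ^ 2 + ∑ j : Fin 2, ‖∂_{planeBasis j} φ y‖ ^ 2)
            positivity)
      _ = C * sobolevEnergy φ := integral_const_mul _ _
  have hlow : ∀ s ∈ Set.Ico 0 L,
      (Metric.ball x (ρ / 2)).indicator (fun y => ‖φ y‖ ^ 2) (γ s) ≤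
        √(1 + K ^ 2) * (χ (γ s) * reForm 1 (φ (γ s)) (φ (γ s)) * ⟪w, ν s⟫_ℝ) := by
    intro s hs
    by_cases hb : γ s ∈ Metric.ball x ρ
    · have hbr : γ s ∈ Metric.ball x r := Metric.ball_subset_ball (min_le_right _ _) hb
      have hbδ : γ s ∈ Metric.ball x δ := Metric.ball_subset_ball (min_le_left _ _) hb
      have hin : ⟪w, ν s⟫_ℝ = 1 / √(1 + deriv g (e (γ s) 0) ^ 2) := by
        rw [(hν s hs).eq_chartPoint hg1 hch hbr, inner_eq_coord e, apply_chartPoint_zero,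
          apply_chartPoint_one, hw0, hw1]
        ring
      have hone : 1 ≤ √(1 + K ^ 2) * ⟪w, ν s⟫_ℝ := by
        have h0 : 0 < √(1 + deriv g (e (γ s) 0) ^ 2) := Real.sqrt_pos.mpr (by positivity)
        rw [hin, mul_one_div, one_le_div h0]
        apply Real.sqrt_le_sqrt
        have := sq_le_sq' (by linarith [abs_nonneg (deriv g (e (γ s) 0)), hδK _ hbδ])
          (hδK _ hbδ).le
        rw [sq_abs] at this
        linarith
      have hle : (Metric.ball x (ρ / 2)).indicator (fun y => ‖φ y‖ ^ 2) (γ s) ≤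
          χ (γ s) * reForm 1 (φ (γ s)) (φ (γ s)) := by
        rw [reForm_one_self]
        by_cases hb2 : γ s ∈ Metric.ball x (ρ / 2)
        · rw [Set.indicator_of_mem hb2,
            χ.one_of_mem_closedBall (Metric.ball_subset_closedBall hb2), one_mul]
        · rw [Set.indicator_of_notMem hb2]
          exact mul_nonneg χ.nonneg (by positivity)
      have h0 : 0 ≤ χ (γ s) * reForm 1 (φ (γ s)) (φ (γ s)) := by
        rw [reForm_one_self]
        exact mul_nonneg χ.nonneg (by positivity)
      nlinarith
    · have hz : χ (γ s) = 0 := by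
        refine χ.zero_of_le_dist ?_
        rw [Metric.mem_ball, not_lt] at hb
        change 3 * ρ / 4 ≤ _
        linarith
      rw [Set.indicator_of_notMem fun h =>
        hb (Metric.ball_subset_ball (by linarith) h), hz]
      simp
  calc _ ≤ ∫ s in Set.Ico 0 L,
        √(1 + K ^ 2) * (χ (γ s) * reForm 1 (φ (γ s)) (φ (γ s)) * ⟪w, ν s⟫_ℝ) :=
        setIntegral_mono_on
          (integrableOn_indicator_boundary hΩb hγ measurableSet_ball (φ.continuous.norm.pow 2))
          ((integrableOn_boundary hΩb hΩ3 hγ hν hf.continuous w).const_mul _)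
          measurableSet_Ico hlow
    _ = √(1 + K ^ 2) * ∫ y in Ω, fderiv ℝ (fun y => χ y * reForm 1 (φ y) (φ y)) y w := by
        rw [integral_const_mul, hdiv]
    _ ≤ √(1 + K ^ 2) * (C * sobolevEnergy φ) := mul_le_mul_of_nonneg_left hup hc.le
    _ = _ := by ring

/-- The trace inequality for Schwartz functions. -/
theorem exists_trace_bound {Ω : Set Plane} (hΩ : IsOpen Ω)
    (hΩb : Bornology.IsBounded Ω) (hΩ3 : HasC3Boundary Ω) {L : ℝ}
    {γ : ℝ → Plane} (hγ : IsArcLengthParam Ω L γ) {ν : ℝ → Plane}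
    (hν : ∀ s ∈ Set.Ico 0 L, IsOutwardUnitNormal Ω (γ s) (ν s)) :
    ∃ C : ℝ, ∀ φ : 𝓢(Plane, Spinor),
      ∫ s in Set.Ico 0 L, ‖φ (γ s)‖ ^ 2 ≤ C * sobolevEnergy φ := by
  have hloc := fun x hx => exists_local_trace_bound hΩ hΩb hΩ3 hγ hν (x := x) hx
  choose! ρ hρ C hC using hloc
  have hK : IsCompact (frontier Ω) :=
    hΩb.isCompact_closure.of_isClosed_subset isClosed_frontier frontier_subset_closure
  obtain ⟨T, hT, hcov⟩ := hK.elim_nhds_subcover (fun x => Metric.ball x (ρ x))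
    fun x hx => Metric.ball_mem_nhds x (hρ x hx)
  refine ⟨∑ x ∈ T, C x, fun φ => ?_⟩
  have hcont : Continuous fun y => ‖φ y‖ ^ 2 := φ.continuous.norm.pow 2
  have hi : ∀ x ∈ T, IntegrableOn
      (fun s => (Metric.ball x (ρ x)).indicator (fun y => ‖φ y‖ ^ 2) (γ s)) (Set.Ico 0 L) :=
    fun x _ => integrableOn_indicator_boundary hΩb hγ measurableSet_ball hcont
  have hi0 : IntegrableOn (fun s => ‖φ (γ s)‖ ^ 2) (Set.Ico 0 L) := by
    simpa using integrableOn_indicator_boundary hΩb hγ MeasurableSet.univ hcont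
  calc _ ≤ ∫ s in Set.Ico 0 L, ∑ x ∈ T,
        (Metric.ball x (ρ x)).indicator (fun y => ‖φ y‖ ^ 2) (γ s) := by
        refine setIntegral_mono_on hi0 (integrable_finsetSum _ hi) measurableSet_Ico fun s hs => ?_
        obtain ⟨x, hxT, hxs⟩ := Set.mem_iUnion₂.mp (hcov (hγ.mem_frontier hs))
        have := Finset.single_le_sum
          (f := fun x => (Metric.ball x (ρ x)).indicator (fun y => ‖φ y‖ ^ 2) (γ s))
          (fun x _ => Set.indicator_nonneg (fun y _ => by positivity) _) hxT
        simpa only [Set.indicator_of_mem hxs] using this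
    _ = ∑ x ∈ T, ∫ s in Set.Ico 0 L,
        (Metric.ball x (ρ x)).indicator (fun y => ‖φ y‖ ^ 2) (γ s) := integral_finsetSum _ hi
    _ ≤ ∑ x ∈ T, C x * sobolevEnergy φ := Finset.sum_le_sum fun x hx => hC x (hT x hx) φ
    _ = _ := (Finset.sum_mul _ _ _).symm

/-! ### Density of the Schwartz functions in `H¹` -/

open FourierTransform TemperedDistribution in
/-- A Fourier multiplier with a bounded symbol acts continuously on `L²`. -/
theorem exists_continuous_fourierMultiplier {g : Plane → ℂ} (hg : g.HasTemperateGrowth) (C : ℝ)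
    (hC : ∀ x, ‖g x‖ ≤ C) :
    ∃ T : SpinorL2 → SpinorL2, Continuous T ∧ ∀ f : SpinorL2,
      TemperedDistribution.fourierMultiplierCLM Spinor g (f : 𝓢'(Plane, Spinor)) =
        (T f : 𝓢'(Plane, Spinor)) := by
  have hgb : MemLp g ⊤ (volume : Measure Plane) :=
    memLp_top_of_bound hg.1.continuous.aestronglyMeasurable C (Eventually.of_forall hC)
  refine ⟨fun f => 𝓕⁻ ((hgb.toLp g) • (𝓕 f) : SpinorL2), ?_, fun f => ?_⟩
  · have h1 : Continuous fun f : SpinorL2 => ((hgb.toLp g) • f : SpinorL2) :=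
      (((ContinuousLinearMap.lsmul ℂ ℂ (E := Spinor)).holderL (volume : Measure Plane) ⊤ 2 2)
        (hgb.toLp g)).continuous
    have h2 : Continuous fun f : SpinorL2 => 𝓕 f := (Lp.fourierTransformₗᵢ Plane Spinor).continuous
    have h3 : Continuous fun f : SpinorL2 => 𝓕⁻ f :=
      (Lp.fourierTransformₗᵢ Plane Spinor).symm.continuous
    exact h3.comp (h1.comp h2)
  · rw [TemperedDistribution.fourierMultiplierCLM_apply, ← Lp.fourierInv_toTemperedDistribution_eq,
      Lp.toTemperedDistribution_smul_eq hg, Lp.fourier_toTemperedDistribution_eq]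

theorem norm_inner_mul_bessel_le (m x : Plane) :
    ‖Complex.ofReal (inner ℝ x m * (1 + ‖x‖ ^ 2) ^ (-1 / 2 : ℝ))‖ ≤ ‖m‖ := by
  rw [Complex.norm_real, norm_mul]
  have h0 : 0 < 1 + ‖x‖ ^ 2 := by positivity
  have h1 : (1 + ‖x‖ ^ 2) ^ (-1 / 2 : ℝ) = (√(1 + ‖x‖ ^ 2))⁻¹ := by
    rw [Real.sqrt_eq_rpow, ← Real.rpow_neg h0.le]
    norm_num
  have h2 : ‖x‖ ≤ √(1 + ‖x‖ ^ 2) := Real.le_sqrt_of_sq_le (by linarith)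
  have hpos : 0 < √(1 + ‖x‖ ^ 2) := Real.sqrt_pos.mpr h0
  rw [h1, norm_inv, Real.norm_of_nonneg hpos.le, mul_inv_le_iff₀ hpos]
  refine (norm_inner_le_norm x m).trans ?_
  rw [mul_comm]
  exact mul_le_mul_of_nonneg_left h2 (norm_nonneg m)

open TemperedDistribution in
-- Symbols of composed multipliers multiply. By `norm_inner_mul_bessel_le` the resulting symbol is
-- bounded, so one derivative of a Bessel potential of order `-1` is bounded on `L²`.
theorem lineDerivOp_besselPotential_neg_one (m : Plane) (f : 𝓢'(Plane, Spinor)) :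
    ∂_{m} (besselPotential Plane Spinor (-1) f) =
      (2 * Real.pi * Complex.I) • TemperedDistribution.fourierMultiplierCLM Spinor
        (fun x => Complex.ofReal (inner ℝ x m * (1 + ‖x‖ ^ 2) ^ (-1 / 2 : ℝ))) f := by
  rw [TemperedDistribution.lineDeriv_eq_fourierMultiplierCLM, besselPotential,
    TemperedDistribution.fourierMultiplierCLM_fourierMultiplierCLM_apply (by fun_prop)
      (by fun_prop)]
  congr 3
  funext x
  simp [mul_comm]

open TemperedDistribution in
theorem exists_continuous_bessel :
    ∃ T : SpinorL2 → SpinorL2, Continuous T ∧ ∀ f : SpinorL2,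
      besselPotential Plane Spinor (-1) (f : 𝓢'(Plane, Spinor)) = (T f : 𝓢'(Plane, Spinor)) := by
  refine exists_continuous_fourierMultiplier (by fun_prop) 1 fun x => ?_
  rw [Complex.norm_real, Real.norm_of_nonneg (by positivity)]
  exact Real.rpow_le_one_of_one_le_of_nonpos (by simp) (by norm_num)

open TemperedDistribution in
theorem exists_continuous_lineDeriv_bessel (m : Plane) :
    ∃ T : SpinorL2 → SpinorL2, Continuous T ∧ ∀ f : SpinorL2,
      ∂_{m} (besselPotential Plane Spinor (-1) (f : 𝓢'(Plane, Spinor))) =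
        (T f : 𝓢'(Plane, Spinor)) := by
  obtain ⟨T, hT, h⟩ := exists_continuous_fourierMultiplier
    (g := fun x : Plane => Complex.ofReal (inner ℝ x m * (1 + ‖x‖ ^ 2) ^ (-1 / 2 : ℝ)))
    (by fun_prop) ‖m‖ (norm_inner_mul_bessel_le m)
  refine ⟨fun f => (2 * Real.pi * Complex.I) • T f, hT.const_smul (2 * Real.pi * Complex.I), fun f => ?_⟩
  rw [lineDerivOp_besselPotential_neg_one, h, ← Lp.toTemperedDistributionCLM_apply,
    ← Lp.toTemperedDistributionCLM_apply, map_smul]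

theorem toTemperedDistribution_lineDerivOp_toLp (φ : 𝓢(Plane, Spinor)) (m : Plane) :
    (((∂_{m} φ).toLp 2 (volume : Measure Plane) : SpinorL2) : 𝓢'(Plane, Spinor)) =
      ∂_{m} ((φ.toLp 2 (volume : Measure Plane) : SpinorL2) : 𝓢'(Plane, Spinor)) := by
  rw [Lp.toTemperedDistribution_toLp_eq, Lp.toTemperedDistribution_toLp_eq,
    TemperedDistribution.lineDerivOp_toTemperedDistributionCLM_eq]

open TemperedDistribution in
-- The symbol has temperate growth, so the multiplier maps Schwartz functions to Schwartz functions,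
-- compatibly with its action on distributions.
theorem exists_schwartz_bessel (h : 𝓢(Plane, Spinor)) :
    ∃ φ : 𝓢(Plane, Spinor),
      ((φ.toLp 2 (volume : Measure Plane) : SpinorL2) : 𝓢'(Plane, Spinor)) =
        besselPotential Plane Spinor (-1)
          ((h.toLp 2 (volume : Measure Plane) : SpinorL2) : 𝓢'(Plane, Spinor)) := by
  refine ⟨SchwartzMap.fourierMultiplierCLM Spinor
    (fun x : Plane => ((1 + ‖x‖ ^ 2) ^ (-1 / 2 : ℝ) : ℝ)) h, ?_⟩
  rw [besselPotential, Lp.toTemperedDistribution_toLp_eq, Lp.toTemperedDistribution_toLp_eq,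
    TemperedDistribution.fourierMultiplierCLM_toTemperedDistributionCLM_eq (by fun_prop)]
  congr 1
  exact (SchwartzMap.fourierMultiplierCLM_ofReal ℂ
    (Function.hasTemperateGrowth_one_add_norm_sq_rpow Plane (-1 / 2)) h).symm

/-- The Schwartz functions are dense in `H¹(ℝ², ℂ²)`. -/
theorem exists_schwartz_tendsto (ψ : spinorH1) :
    ∃ φ : ℕ → 𝓢(Plane, Spinor),
      Tendsto (fun n => (φ n).toLp 2 (volume : Measure Plane)) atTop (𝓝 (ψ : SpinorL2)) ∧
      ∀ j : Fin 2, Tendsto (fun n => (∂_{planeBasis j} (φ n)).toLp 2 (volume : Measure Plane))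
        atTop (𝓝 (weakDeriv (planeBasis j) ψ)) := by
  -- By definition of `H¹`, `ψ` is the Bessel potential of order `-1` of some `G` in `L²`.
  -- Approximating `G` in `L²` by Schwartz functions and applying the potential approximates `ψ`
  -- together with its derivatives.
  obtain ⟨G, hG⟩ : TemperedDistribution.MemSobolev 1 2 ((ψ : SpinorL2) : 𝓢'(Plane, Spinor)) := ψ.2
  have hψ : ((ψ : SpinorL2) : 𝓢'(Plane, Spinor)) =
      TemperedDistribution.besselPotential Plane Spinor (-1) (G : 𝓢'(Plane, Spinor)) := by
    rw [← hG]
    simp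
  have hdense := SchwartzMap.denseRange_toLpCLM (F := Spinor) (E := Plane) (μ := volume)
    (p := 2) ENNReal.ofNat_ne_top
  obtain ⟨u, hu, hlim⟩ := mem_closure_iff_seq_limit.mp (hdense G)
  choose h hh using hu
  choose φ hφ using fun n => exists_schwartz_bessel (h n)
  have hlim' : Tendsto (fun n => (h n).toLp 2 (volume : Measure Plane)) atTop (𝓝 G) :=
    hlim.congr fun n => (hh n).symm
  obtain ⟨T, hT, hTe⟩ := exists_continuous_bessel
  refine ⟨φ, ?_, fun j => ?_⟩
  · have e1 : (ψ : SpinorL2) = T G := toTemperedDistribution_inj (by rw [hψ, hTe])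
    have e2 : ∀ n, (φ n).toLp 2 (volume : Measure Plane) = T ((h n).toLp 2 volume) := fun n =>
      toTemperedDistribution_inj (by rw [hφ, hTe])
    simp_rw [e1, e2]
    exact (hT.tendsto G).comp hlim'
  · obtain ⟨S, hS, hSe⟩ := exists_continuous_lineDeriv_bessel (planeBasis j)
    have e1 : weakDeriv (planeBasis j) ψ = S G := toTemperedDistribution_inj (by
      rw [← hSe, ← hψ]
      exact (exists_weakDeriv (planeBasis j) ψ).choose_spec.symm)
    have e2 : ∀ n, (∂_{planeBasis j} (φ n)).toLp 2 (volume : Measure Plane) =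
        S ((h n).toLp 2 volume) := fun n =>
      toTemperedDistribution_inj (by rw [toTemperedDistribution_lineDerivOp_toLp, hφ, hSe])
    simp_rw [e1, e2]
    exact (hS.tendsto G).comp hlim'

/-! ### Pauli matrix algebra -/

theorem matAct_apply (A : Matrix (Fin 2) (Fin 2) ℂ) (v : Spinor) (i : Fin 2) :
    matAct A v i = A i 0 * v 0 + A i 1 * v 1 := by
  simp [matAct, Matrix.ofLp_toEuclideanCLM, Matrix.mulVec, dotProduct, Fin.sum_univ_two]

theorem spinor_norm_sq (v : Spinor) :
    ‖v‖ ^ 2 = ((v 0).re ^ 2 + (v 0).im ^ 2) + ((v 1).re ^ 2 + (v 1).im ^ 2) := by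
  rw [EuclideanSpace.norm_sq_eq, Fin.sum_univ_two]
  simp only [Complex.sq_norm, Complex.normSq_apply]
  ring

theorem reForm_eq_coord (A : Matrix (Fin 2) (Fin 2) ℂ) (v w : Spinor) :
    reForm A v w = (v 0).re * (matAct A w 0).re + (v 0).im * (matAct A w 0).im +
      ((v 1).re * (matAct A w 1).re + (v 1).im * (matAct A w 1).im) := by
  rw [reForm_apply, PiLp.inner_apply, Fin.sum_univ_two]
  simp [Complex.mul_re]
  ring

theorem reForm_pauli₁ (v w : Spinor) :
    reForm pauli₁ v w = (v 0).re * (w 1).re + (v 0).im * (w 1).im +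
      ((v 1).re * (w 0).re + (v 1).im * (w 0).im) := by
  simp [reForm_eq_coord, matAct_apply, pauli₁]

theorem reForm_pauli₂ (v w : Spinor) :
    reForm pauli₂ v w = (v 0).re * (w 1).im - (v 0).im * (w 1).re +
      ((v 1).im * (w 0).re - (v 1).re * (w 0).im) := by
  simp [reForm_eq_coord, matAct_apply, pauli₂]
  ring

theorem reForm_pauli₁_mul_pauli₂ (v w : Spinor) :
    reForm (pauli₁ * pauli₂) v w = (v 0).im * (w 0).re - (v 0).re * (w 0).im +
      ((v 1).re * (w 1).im - (v 1).im * (w 1).re) := by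
  simp [reForm_eq_coord, matAct_apply, pauli₁, pauli₂]
  ring

theorem reForm_pauli₁_mul_pauli₂_swap (v w : Spinor) :
    reForm (pauli₁ * pauli₂) v w = -reForm (pauli₁ * pauli₂) w v := by
  rw [reForm_pauli₁_mul_pauli₂, reForm_pauli₁_mul_pauli₂]
  ring

/-- The real bilinear form `(v, w) ↦ Re ⟨v, i σⱼ σ₃ w⟩`. -/
noncomputable def fluxForm (j : Fin 2) : Spinor →L[ℝ] Spinor →L[ℝ] ℝ :=
  ![reForm pauli₂, -reForm pauli₁] j

/-- The integrand of `‖H_M ψ‖²`, with `p`, `q` the partial derivatives of `ψ` and `c` the mass. -/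
theorem norm_sq_dirac (p q v : Spinor) (c : ℝ) :
    ‖(1 / Complex.I) • (matAct pauli₁ p + matAct pauli₂ q) + (c : ℂ) • matAct pauli₃ v‖ ^ 2 =
      (‖p‖ ^ 2 + ‖q‖ ^ 2) + 2 * reForm (pauli₁ * pauli₂) p q + c ^ 2 * ‖v‖ ^ 2 +
        c * (fluxForm 0 v p + fluxForm 0 p v + (fluxForm 1 v q + fluxForm 1 q v)) := by
  simp only [fluxForm, Matrix.cons_val_zero, Matrix.cons_val_one, _root_.neg_apply]
  rw [spinor_norm_sq, spinor_norm_sq, spinor_norm_sq, spinor_norm_sq, reForm_pauli₁_mul_pauli₂,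
    reForm_pauli₂, reForm_pauli₂, reForm_pauli₁, reForm_pauli₁]
  simp [matAct_apply, pauli₁, pauli₂, pauli₃]
  ring

theorem norm_sq_projPlus (t : ℝ) (v : Spinor) :
    ‖matAct (projPlus t) v‖ ^ 2 =
      (‖v‖ ^ 2 + (Real.cos t * fluxForm 0 v v + Real.sin t * fluxForm 1 v v)) / 2 := by
  simp only [fluxForm, Matrix.cons_val_zero, Matrix.cons_val_one, _root_.neg_apply]
  have hcs := Real.sin_sq_add_cos_sq t
  rw [spinor_norm_sq, spinor_norm_sq, reForm_pauli₂, reForm_pauli₁]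
  have he : Complex.exp (Complex.I * t) = Complex.cos t + Complex.sin t * Complex.I := by
    rw [mul_comm, Complex.exp_mul_I]
  simp only [matAct_apply, projPlus, boundaryMatrix, he, ← Complex.ofReal_cos,
    ← Complex.ofReal_sin]
  simp [-Complex.ofReal_cos, -Complex.ofReal_sin]
  generalize Real.cos t = C at *
  generalize Real.sin t = S at *
  -- The two sides differ by a multiple of `sin² + cos² = 1`, that is of `A² = 1`.
  linear_combination ((v 0).re ^ 2 + (v 0).im ^ 2 + (v 1).re ^ 2 + (v 1).im ^ 2) / 4 * hcs

theorem norm_sq_projMinus (t : ℝ) (v : Spinor) :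
    ‖matAct (projMinus t) v‖ ^ 2 =
      (‖v‖ ^ 2 - (Real.cos t * fluxForm 0 v v + Real.sin t * fluxForm 1 v v)) / 2 := by
  simp only [fluxForm, Matrix.cons_val_zero, Matrix.cons_val_one, _root_.neg_apply]
  have hcs := Real.sin_sq_add_cos_sq t
  rw [spinor_norm_sq, spinor_norm_sq, reForm_pauli₂, reForm_pauli₁]
  have he : Complex.exp (Complex.I * t) = Complex.cos t + Complex.sin t * Complex.I := by
    rw [mul_comm, Complex.exp_mul_I]
  simp only [matAct_apply, projMinus, boundaryMatrix, he, ← Complex.ofReal_cos,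
    ← Complex.ofReal_sin]
  simp [-Complex.ofReal_cos, -Complex.ofReal_sin]
  generalize Real.cos t = C at *
  generalize Real.sin t = S at *
  linear_combination ((v 0).re ^ 2 + (v 0).im ^ 2 + (v 1).re ^ 2 + (v 1).im ^ 2) / 4 * hcs

theorem norm_projPlus_le (t : ℝ) (v : Spinor) : ‖matAct (projPlus t) v‖ ≤ ‖v‖ := by
  have h1 := norm_sq_projPlus t v
  have h2 := norm_sq_projMinus t v
  exact le_of_sq_le_sq (by nlinarith [sq_nonneg ‖matAct (projMinus t) v‖]) (norm_nonneg v)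

theorem norm_projMinus_le (t : ℝ) (v : Spinor) : ‖matAct (projMinus t) v‖ ≤ ‖v‖ := by
  have h1 := norm_sq_projPlus t v
  have h2 := norm_sq_projMinus t v
  exact le_of_sq_le_sq (by nlinarith [sq_nonneg ‖matAct (projPlus t) v‖]) (norm_nonneg v)

/-! ### The energy identity for Schwartz functions -/

theorem integrable_bilinear (B : Spinor →L[ℝ] Spinor →L[ℝ] ℝ) (φ χ : 𝓢(Plane, Spinor)) :
    Integrable fun y => B (φ y) (χ y) :=
  ((SchwartzMap.pairing B φ χ).integrable (μ := volume)).congr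
    (Eventually.of_forall fun y => SchwartzMap.pairing_apply_apply B φ χ y)

theorem lineDerivOp_comm (φ : 𝓢(Plane, Spinor)) (v w : Plane) :
    ∂_{v} (∂_{w} φ) = ∂_{w} (∂_{v} φ) := by
  ext1 x
  have hd : DifferentiableAt ℝ (fderiv ℝ φ) x :=
    ((φ.smooth 2).fderiv_right (m := 1) (by norm_num)).differentiable one_ne_zero x
  have key : ∀ v w : Plane, (∂_{v} (∂_{w} φ)) x = fderiv ℝ (fderiv ℝ φ) x v w := by
    intro v w
    rw [SchwartzMap.lineDerivOp_apply_eq_fderiv]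
    have : ⇑(∂_{w} φ : 𝓢(Plane, Spinor)) = fun y => fderiv ℝ φ y w := by
      ext1 y
      exact SchwartzMap.lineDerivOp_apply_eq_fderiv w φ y
    rw [this, fderiv_clm_apply hd (differentiableAt_const w)]
    simp
  rw [key, key]
  exact ((φ.smooth 2).contDiffAt.isSymmSndFDerivAt (by simp)) v w

theorem integral_cross_derivative_eq_zero {B : Spinor →L[ℝ] Spinor →L[ℝ] ℝ}
    (hB : ∀ v w, B v w = -B w v) (φ : 𝓢(Plane, Spinor)) (v w : Plane) :
    ∫ y, B (∂_{v} φ y) (∂_{w} φ y) = 0 := by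
  have h1 := SchwartzMap.integral_bilinear_lineDerivOp_right_eq_neg_left (μ := volume)
    (∂_{v} φ) φ B w
  have h2 := SchwartzMap.integral_bilinear_lineDerivOp_right_eq_neg_left (μ := volume)
    φ (∂_{w} φ) B v
  -- With `I` the integral sought, moving either derivative gives `I = -∫ B(∂_w ∂_v φ, φ)` and `∫
  -- B(φ, ∂_v ∂_w φ) = -I`. Antisymmetry and equality of mixed derivatives then yield `I = -I`.
  have h3 : ∫ y, B (φ y) (∂_{v} (∂_{w} φ) y) = -∫ y, B (∂_{w} (∂_{v} φ) y) (φ y) := by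
    rw [← integral_neg, lineDerivOp_comm φ v w]
    exact integral_congr_ae (Eventually.of_forall fun y => hB _ _)
  linarith

theorem integral_fderiv_bilinear_self_eq_zero (B : Spinor →L[ℝ] Spinor →L[ℝ] ℝ)
    (φ : 𝓢(Plane, Spinor)) (w : Plane) :
    ∫ y, fderiv ℝ (fun y => B (φ y) (φ y)) y w = 0 := by
  simp_rw [fderiv_bilinear_self]
  rw [integral_add (integrable_bilinear B φ _) (integrable_bilinear B _ φ),
    SchwartzMap.integral_bilinear_lineDerivOp_right_eq_neg_left]
  ring

theorem integrable_fderiv_bilinear_self (B : Spinor →L[ℝ] Spinor →L[ℝ] ℝ)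
    (φ : 𝓢(Plane, Spinor)) (w : Plane) :
    Integrable fun y => fderiv ℝ (fun y => B (φ y) (φ y)) y w := by
  simp_rw [fderiv_bilinear_self]
  exact (integrable_bilinear B φ _).add (integrable_bilinear B _ φ)

/-- The integral over the whole plane is zero, so the exterior contributes minus the interior; the
divergence theorem is needed only on the bounded set. -/
theorem setIntegral_compl_fderiv_bilinear_self {Ω : Set Plane} (hΩ : IsOpen Ω)
    (hΩb : Bornology.IsBounded Ω) (hΩ3 : HasC3Boundary Ω) {L : ℝ}
    {γ : ℝ → Plane} (hγ : IsArcLengthParam Ω L γ) {ν : ℝ → Plane}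
    (hν : ∀ s ∈ Set.Ico 0 L, IsOutwardUnitNormal Ω (γ s) (ν s))
    (B : Spinor →L[ℝ] Spinor →L[ℝ] ℝ) (φ : 𝓢(Plane, Spinor)) (w : Plane) :
    ∫ y in Ωᶜ, fderiv ℝ (fun y => B (φ y) (φ y)) y w =
      -∫ s in Set.Ico 0 L, B (φ (γ s)) (φ (γ s)) * ⟪w, ν s⟫_ℝ := by
  have h := integral_add_compl hΩ.measurableSet (integrable_fderiv_bilinear_self B φ w)
  rw [integral_fderiv_bilinear_self_eq_zero,
    setIntegral_fderiv_eq_boundary hΩ hΩb hΩ3 hγ hν (contDiff_bilinear_self B φ) w] at h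
  linarith

theorem norm_sq_eq_integral {E F : Type*} [NormedAddCommGroup F] [MeasurableSpace E]
    {μ : Measure E} (f : Lp F 2 μ) : ‖f‖ ^ 2 = ∫ y, ‖f y‖ ^ 2 ∂μ := by
  rw [integral_norm_sq_eq_norm_toLp (Lp.memLp f), Lp.toLp_coeFn]

theorem cutOutside_coeFn (Ω : TopologicalSpace.Opens Plane) (u : SpinorL2) :
    cutOutside Ω u =ᵐ[volume] (Ω : Set Plane)ᶜ.indicator u :=
  (memLp_cutOutside Ω u).coeFn_toLp

theorem norm_sq_cutOutside (Ω : TopologicalSpace.Opens Plane) (u : SpinorL2) :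
    ‖cutOutside Ω u‖ ^ 2 = ∫ y in (Ω : Set Plane)ᶜ, ‖u y‖ ^ 2 := by
  rw [norm_sq_eq_integral, ← integral_indicator Ω.isOpen.measurableSet.compl]
  refine integral_congr_ae ?_
  filter_upwards [cutOutside_coeFn Ω u] with y hy
  rw [hy]
  by_cases h : y ∈ (Ω : Set Plane)ᶜ
  · rw [Set.indicator_of_mem h, Set.indicator_of_mem h]
  · rw [Set.indicator_of_notMem h, Set.indicator_of_notMem h]
    simp

theorem continuous_cutOutside (Ω : TopologicalSpace.Opens Plane) : Continuous (cutOutside Ω) := by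
  refine AddMonoidHomClass.continuous_of_bound (cutOutside Ω) 1 fun u => ?_
  rw [one_mul]
  refine le_of_sq_le_sq ?_ (norm_nonneg u)
  rw [norm_sq_cutOutside, norm_sq_eq_integral u]
  exact setIntegral_le_integral ((Lp.memLp u).integrable_norm_pow two_ne_zero)
    (Eventually.of_forall fun y => sq_nonneg ‖u y‖)

/-- `H_M ψ` in terms of `ψ` and its weak derivatives. -/
noncomputable def diracAction (Ω : TopologicalSpace.Opens Plane) (M : ℝ) (u p q : SpinorL2) :
    SpinorL2 :=
  (1 / Complex.I) • (matActL2 pauli₁ p + matActL2 pauli₂ q) +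
    (M : ℂ) • matActL2 pauli₃ (cutOutside Ω u)

theorem diracHM_eq_diracAction (Ω : TopologicalSpace.Opens Plane) (M : ℝ)
    (ψ : (diracHM Ω M).domain) :
    diracHM Ω M ψ = diracAction Ω M (ψ : SpinorL2) (weakDeriv (planeBasis 0) ψ)
      (weakDeriv (planeBasis 1) ψ) := rfl

theorem matActL2_coeFn (A : Matrix (Fin 2) (Fin 2) ℂ) (u : SpinorL2) :
    matActL2 A u =ᵐ[volume] fun y => matAct A (u y) :=
  ContinuousLinearMap.coeFn_compLpL (matAct A) u

theorem continuous_matActL2 (A : Matrix (Fin 2) (Fin 2) ℂ) : Continuous (matActL2 A) :=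
  (ContinuousLinearMap.compLpL 2 (volume : Measure Plane) (matAct A)).continuous

theorem continuous_diracAction (Ω : TopologicalSpace.Opens Plane) (M : ℝ) :
    Continuous fun x : SpinorL2 × SpinorL2 × SpinorL2 => diracAction Ω M x.1 x.2.1 x.2.2 := by
  have h1 := continuous_matActL2 pauli₁
  have h2 := continuous_matActL2 pauli₂
  have h3 := (continuous_matActL2 pauli₃).comp (continuous_cutOutside Ω)
  exact (((h1.comp (continuous_fst.comp continuous_snd)).add
    (h2.comp (continuous_snd.comp continuous_snd))).const_smul (1 / Complex.I)).add
      ((h3.comp continuous_fst).const_smul (M : ℂ))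

theorem diracAction_coeFn (Ω : TopologicalSpace.Opens Plane) (M : ℝ) (u p q : SpinorL2) :
    diracAction Ω M u p q =ᵐ[volume] fun y =>
      (1 / Complex.I) • (matAct pauli₁ (p y) + matAct pauli₂ (q y)) +
        (M : ℂ) • matAct pauli₃ ((Ω : Set Plane)ᶜ.indicator u y) := by
  unfold diracAction
  filter_upwards [Lp.coeFn_add ((1 / Complex.I) • (matActL2 pauli₁ p + matActL2 pauli₂ q))
      ((M : ℂ) • matActL2 pauli₃ (cutOutside Ω u)),
    Lp.coeFn_smul (1 / Complex.I) (matActL2 pauli₁ p + matActL2 pauli₂ q),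
    Lp.coeFn_add (matActL2 pauli₁ p) (matActL2 pauli₂ q),
    Lp.coeFn_smul (M : ℂ) (matActL2 pauli₃ (cutOutside Ω u)),
    matActL2_coeFn pauli₁ p, matActL2_coeFn pauli₂ q, matActL2_coeFn pauli₃ (cutOutside Ω u),
    cutOutside_coeFn Ω u] with y h1 h2 h3 h4 h5 h6 h7 h8
  rw [h1, Pi.add_apply, h2, h4, Pi.smul_apply, Pi.smul_apply, h3, Pi.add_apply, h5, h6, h7, h8]

/-- The energy identity for Schwartz functions. -/
theorem norm_sq_diracAction_schwartz (Ω : TopologicalSpace.Opens Plane)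
    (hΩb : Bornology.IsBounded (Ω : Set Plane)) (hΩ3 : HasC3Boundary (Ω : Set Plane)) {L : ℝ}
    {γ : ℝ → Plane} (hγ : IsArcLengthParam (Ω : Set Plane) L γ) {α : ℝ → ℝ}
    (hα : ∀ s ∈ Set.Ico 0 L,
      IsOutwardUnitNormal (Ω : Set Plane) (γ s) !₂[Real.cos (α s), Real.sin (α s)])
    (M : ℝ) (φ : 𝓢(Plane, Spinor)) :
    ‖diracAction Ω M (φ.toLp 2 volume) ((∂_{planeBasis 0} φ).toLp 2 volume)
        ((∂_{planeBasis 1} φ).toLp 2 volume)‖ ^ 2 =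
      ‖(∂_{planeBasis 0} φ).toLp 2 (volume : Measure Plane)‖ ^ 2 +
        ‖(∂_{planeBasis 1} φ).toLp 2 (volume : Measure Plane)‖ ^ 2 +
        M ^ 2 * ‖cutOutside Ω (φ.toLp 2 volume)‖ ^ 2 -
        M * ∫ s in Set.Ico 0 L, (‖matAct (projPlus (α s)) (φ (γ s))‖ ^ 2 -
          ‖matAct (projMinus (α s)) (φ (γ s))‖ ^ 2) := by
  have hm := Ω.isOpen.measurableSet.compl
  set p := ∂_{planeBasis 0} φ with hp
  set q := ∂_{planeBasis 1} φ with hq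
  -- The divergence of the flux field; off `Ω`, `M * D` is the cross term between the derivatives
  -- and the mass.
  let D : Plane → ℝ := fun y => fderiv ℝ (fun y => fluxForm 0 (φ y) (φ y)) y (planeBasis 0) +
    fderiv ℝ (fun y => fluxForm 1 (φ y) (φ y)) y (planeBasis 1)
  have hDi : Integrable D := (integrable_fderiv_bilinear_self _ φ _).add
    (integrable_fderiv_bilinear_self _ φ _)
  have hpt : ∀ᵐ y, ‖diracAction Ω M (φ.toLp 2 volume) (p.toLp 2 volume) (q.toLp 2 volume) y‖ ^ 2 =
      (‖p y‖ ^ 2 + ‖q y‖ ^ 2) + 2 * reForm (pauli₁ * pauli₂) (p y) (q y) +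
        (Ω : Set Plane)ᶜ.indicator (fun y => M ^ 2 * ‖φ y‖ ^ 2 + M * D y) y := by
    filter_upwards [diracAction_coeFn Ω M (φ.toLp 2 volume) (p.toLp 2 volume) (q.toLp 2 volume),
      φ.coeFn_toLp 2 volume, p.coeFn_toLp 2 volume, q.coeFn_toLp 2 volume] with y h h0 h1 h2
    rw [h, h1, h2]
    by_cases hy : y ∈ (Ω : Set Plane)ᶜ
    · rw [Set.indicator_of_mem hy, Set.indicator_of_mem hy, h0, norm_sq_dirac]
      simp only [D, fderiv_bilinear_self, ← hp, ← hq]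
      ring
    · rw [Set.indicator_of_notMem hy, Set.indicator_of_notMem hy, norm_sq_dirac]
      simp
  have hbd : ∫ s in Set.Ico 0 L, (‖matAct (projPlus (α s)) (φ (γ s))‖ ^ 2 -
      ‖matAct (projMinus (α s)) (φ (γ s))‖ ^ 2) = -∫ y in (Ω : Set Plane)ᶜ, D y := by
    have hcont : ∀ j, Continuous fun y => fluxForm j (φ y) (φ y) := fun j =>
      (contDiff_bilinear_self (fluxForm j) φ).continuous
    simp only [D]
    rw [integral_add (integrable_fderiv_bilinear_self _ φ _).integrableOn
        (integrable_fderiv_bilinear_self _ φ _).integrableOn,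
      setIntegral_compl_fderiv_bilinear_self Ω.isOpen hΩb hΩ3 hγ hα,
      setIntegral_compl_fderiv_bilinear_self Ω.isOpen hΩb hΩ3 hγ hα, ← neg_add, neg_neg,
      ← integral_add (integrableOn_boundary hΩb hΩ3 hγ hα (hcont 0) _)
        (integrableOn_boundary hΩb hΩ3 hγ hα (hcont 1) _)]
    congr 1
    ext s
    rw [norm_sq_projPlus, norm_sq_projMinus]
    simp [planeBasis, EuclideanSpace.inner_single_left]
    ring
  have hφ2 : ∫ y in (Ω : Set Plane)ᶜ, ‖φ y‖ ^ 2 = ‖cutOutside Ω (φ.toLp 2 volume)‖ ^ 2 := by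
    rw [norm_sq_cutOutside]
    refine integral_congr_ae (ae_restrict_of_ae ?_)
    filter_upwards [φ.coeFn_toLp 2 volume] with y hy
    rw [hy]
  have hpq : ∀ χ : 𝓢(Plane, Spinor), ∫ y, ‖χ y‖ ^ 2 = ‖χ.toLp 2 (volume : Measure Plane)‖ ^ 2 :=
    fun χ => integral_norm_sq_eq_norm_toLp (χ.memLp 2 volume)
  have hi1 : Integrable fun y => ‖p y‖ ^ 2 + ‖q y‖ ^ 2 :=
    (integrable_norm_sq p).add (integrable_norm_sq q)
  have hi2 := (integrable_bilinear (reForm (pauli₁ * pauli₂)) p q).const_mul 2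
  have hi12 : Integrable fun y => ‖p y‖ ^ 2 + ‖q y‖ ^ 2 +
    2 * reForm (pauli₁ * pauli₂) (p y) (q y) := hi1.add hi2
  have hi3 := (integrable_norm_sq φ).const_mul (M ^ 2)
  have hi4 := hDi.const_mul M
  have hi34 : Integrable fun y => M ^ 2 * ‖φ y‖ ^ 2 + M * D y := hi3.add hi4
  rw [norm_sq_eq_integral, integral_congr_ae hpt, integral_add hi12
    (hi34.indicator hm), integral_add hi1 hi2, integral_add (integrable_norm_sq p)
    (integrable_norm_sq q), integral_indicator hm, integral_add hi3.integrableOn hi4.integrableOn,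
    integral_const_mul, integral_const_mul, integral_const_mul,
    integral_cross_derivative_eq_zero reForm_pauli₁_mul_pauli₂_swap, hbd, hφ2, hpq, hpq]
  ring

/-! ### Existence of the boundary trace -/

theorem memLp_boundary (φ : 𝓢(Plane, Spinor)) {Ω : Set Plane} {L : ℝ} {γ : ℝ → Plane}
    (hγ : IsArcLengthParam Ω L γ) :
    MemLp (fun s => φ (γ s)) 2 (volume.restrict (Set.Ico 0 L)) :=
  MemLp.of_bound (φ.continuous.comp_aestronglyMeasurable hγ.aestronglyMeasurable)
    (SchwartzMap.seminorm ℝ 0 0 φ)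
    (Eventually.of_forall fun s => SchwartzMap.norm_le_seminorm ℝ φ (γ s))

/-- The classes in `L²` of a Schwartz function and of its partial derivatives. -/
noncomputable def schwartzJet (φ : 𝓢(Plane, Spinor)) : SpinorL2 × SpinorL2 × SpinorL2 :=
  (φ.toLp 2 volume, (∂_{planeBasis 0} φ).toLp 2 volume, (∂_{planeBasis 1} φ).toLp 2 volume)

theorem schwartzJet_sub (φ χ : 𝓢(Plane, Spinor)) :
    schwartzJet (φ - χ) = schwartzJet φ - schwartzJet χ := by
  have h : ∀ f g : 𝓢(Plane, Spinor), (f - g).toLp 2 (volume : Measure Plane) =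
      f.toLp 2 volume - g.toLp 2 volume := fun f g =>
    map_sub (SchwartzMap.toLpCLM ℂ Spinor 2 (volume : Measure Plane)) f g
  have hd : ∀ v : Plane, ∂_{v} (φ - χ) = ∂_{v} φ - ∂_{v} χ := fun v =>
    map_sub (LineDeriv.lineDerivOpCLM ℂ 𝓢(Plane, Spinor) v) φ χ
  simp only [schwartzJet, h, hd, Prod.mk_sub_mk]

theorem sobolevEnergy_le (φ : 𝓢(Plane, Spinor)) : sobolevEnergy φ ≤ 3 * ‖schwartzJet φ‖ ^ 2 := by
  have hpq : ∀ χ : 𝓢(Plane, Spinor), ∫ y, ‖χ y‖ ^ 2 = ‖χ.toLp 2 (volume : Measure Plane)‖ ^ 2 :=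
    fun χ => integral_norm_sq_eq_norm_toLp (χ.memLp 2 volume)
  have h : sobolevEnergy φ = ‖(schwartzJet φ).1‖ ^ 2 +
      (‖(schwartzJet φ).2.1‖ ^ 2 + ‖(schwartzJet φ).2.2‖ ^ 2) := by
    rw [sobolevEnergy, integral_add (integrable_norm_sq φ)
      (integrable_finsetSum _ fun _ _ => integrable_norm_sq _),
      integral_finsetSum _ fun _ _ => integrable_norm_sq _, Fin.sum_univ_two, hpq, hpq, hpq]
    rfl
  have h1 := norm_fst_le (schwartzJet φ)
  have h2 := (norm_fst_le (schwartzJet φ).2).trans (norm_snd_le (schwartzJet φ))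
  have h3 := (norm_snd_le (schwartzJet φ).2).trans (norm_snd_le (schwartzJet φ))
  have e1 := pow_le_pow_left₀ (norm_nonneg _) h1 2
  have e2 := pow_le_pow_left₀ (norm_nonneg _) h2 2
  have e3 := pow_le_pow_left₀ (norm_nonneg _) h3 2
  rw [h]
  linarith

theorem exists_isBoundaryTrace {Ω : Set Plane} (hΩ : IsOpen Ω)
    (hΩb : Bornology.IsBounded Ω) (hΩ3 : HasC3Boundary Ω) {L : ℝ}
    {γ : ℝ → Plane} (hγ : IsArcLengthParam Ω L γ) {ν : ℝ → Plane}
    (hν : ∀ s ∈ Set.Ico 0 L, IsOutwardUnitNormal Ω (γ s) (ν s)) (ψ : spinorH1) :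
    ∃ τ : ℝ → Spinor, IsBoundaryTrace L γ ψ τ := by
  obtain ⟨φ, hφ, hdφ⟩ := exists_schwartz_tendsto ψ
  obtain ⟨C, hC⟩ := exists_trace_bound hΩ hΩb hΩ3 hγ hν
  set F : ℕ → Lp Spinor 2 (volume.restrict (Set.Ico 0 L)) :=
    fun n => (memLp_boundary (φ n) hγ).toLp _ with hF
  have hjet : CauchySeq fun n => schwartzJet (φ n) :=
    (hφ.prodMk_nhds ((hdφ 0).prodMk_nhds (hdφ 1))).cauchySeq
  -- The trace inequality for `φ n - φ m`; the `3` bounds the energy by the maximum norm of the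
  -- three `L²` components.
  have hdist : ∀ n m, dist (F n) (F m) ≤
      √(3 * |C|) * dist (schwartzJet (φ n)) (schwartzJet (φ m)) := by
    intro n m
    rw [dist_eq_norm, dist_eq_norm, ← schwartzJet_sub]
    refine le_of_sq_le_sq ?_ (by positivity)
    have h1 : F n - F m = (memLp_boundary (φ n - φ m) hγ).toLp _ :=
      (MemLp.toLp_sub (memLp_boundary (φ n) hγ) (memLp_boundary (φ m) hγ)).symm
    rw [h1, ← integral_norm_sq_eq_norm_toLp, mul_pow, Real.sq_sqrt (by positivity)]
    have h0 : 0 ≤ sobolevEnergy (φ n - φ m) := integral_nonneg fun y => by positivity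
    have h2 := hC (φ n - φ m)
    have h3 := mul_le_mul_of_nonneg_right (le_abs_self C) h0
    have h4 := mul_le_mul_of_nonneg_left (sobolevEnergy_le (φ n - φ m)) (abs_nonneg C)
    linarith
  have hFc : CauchySeq F := by
    rw [cauchySeq_iff_tendsto_dist_atTop_0] at hjet ⊢
    refine squeeze_zero (fun _ => dist_nonneg) (fun p => hdist p.1 p.2) ?_
    simpa using hjet.const_mul √(3 * |C|)
  obtain ⟨T, hT⟩ := cauchySeq_tendsto_of_complete hFc
  refine ⟨T, Lp.memLp T, φ, hφ, hdφ, ?_⟩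
  rw [Lp.tendsto_Lp_iff_tendsto_eLpNorm'] at hT
  refine hT.congr fun n => eLpNorm_congr_ae ?_
  filter_upwards [(memLp_boundary (φ n) hγ).coeFn_toLp] with s hs
  rw [Pi.sub_apply, hF, hs]

/-! ### Passing to the limit -/

theorem tendsto_integral_norm_sq {μ : Measure ℝ} {F : ℕ → ℝ → Spinor} {G : ℝ → Spinor}
    (hF : ∀ n, MemLp (F n) 2 μ) (hG : MemLp G 2 μ)
    (h : Tendsto (fun n => eLpNorm (fun s => F n s - G s) 2 μ) atTop (𝓝 0)) :
    Tendsto (fun n => ∫ s, ‖F n s‖ ^ 2 ∂μ) atTop (𝓝 (∫ s, ‖G s‖ ^ 2 ∂μ)) := by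
  have h1 := (Lp.tendsto_Lp_iff_tendsto_eLpNorm'' F hF G hG).mpr h
  simp_rw [integral_norm_sq_eq_norm_toLp hG, fun n => integral_norm_sq_eq_norm_toLp (hF n)]
  exact h1.norm.pow 2

theorem matAct_projPlus_eq (t : ℝ) (v : Spinor) :
    matAct (projPlus t) v = (1 / 2 : ℂ) • (v + ((Real.cos t : ℂ) • matAct pauli₂ v -
      (Real.sin t : ℂ) • matAct pauli₁ v)) := by
  have he : Complex.exp (Complex.I * t) = Complex.cos t + Complex.sin t * Complex.I := by
    rw [mul_comm, Complex.exp_mul_I]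
  ext i
  fin_cases i <;>
    apply Complex.ext <;>
      simp [-Complex.ofReal_cos, -Complex.ofReal_sin, matAct_apply, projPlus, boundaryMatrix, he,
        ← Complex.ofReal_cos, ← Complex.ofReal_sin, pauli₁, pauli₂] <;> ring

theorem matAct_projMinus_eq (t : ℝ) (v : Spinor) :
    matAct (projMinus t) v = v - matAct (projPlus t) v := by
  have : projMinus t = 1 - projPlus t := by
    rw [projMinus, projPlus, eq_sub_iff_add_eq, ← smul_add]
    rw [sub_add_add_cancel, ← two_smul ℂ, smul_smul]
    norm_num
  rw [this]
  have h : matAct (1 - projPlus t) = matAct 1 - matAct (projPlus t) :=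
    map_sub (Matrix.toEuclideanCLM (n := Fin 2) (𝕜 := ℂ)) _ _
  rw [h, _root_.sub_apply, matAct_one_apply]

/-- The angle `α` itself need not be measurable: the projection depends on it only through its
cosine and sine, the components of the normal. -/
theorem aestronglyMeasurable_projPlus {μ : Measure ℝ} {α : ℝ → ℝ}
    (hα : AEStronglyMeasurable (fun s => !₂[Real.cos (α s), Real.sin (α s)]) μ)
    {F : ℝ → Spinor} (hF : AEStronglyMeasurable F μ) :
    AEStronglyMeasurable (fun s => matAct (projPlus (α s)) (F s)) μ := by
  have hc : AEStronglyMeasurable (fun s => (Real.cos (α s) : ℂ)) μ :=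
    (show Continuous fun x : Plane => (x 0 : ℂ) by fun_prop).comp_aestronglyMeasurable hα
  have hs : AEStronglyMeasurable (fun s => (Real.sin (α s) : ℂ)) μ :=
    (show Continuous fun x : Plane => (x 1 : ℂ) by fun_prop).comp_aestronglyMeasurable hα
  simp_rw [matAct_projPlus_eq]
  exact (hF.add ((hc.smul ((matAct pauli₂).continuous.comp_aestronglyMeasurable hF)).sub
    (hs.smul ((matAct pauli₁).continuous.comp_aestronglyMeasurable hF)))).const_smul (1 / 2 : ℂ)

/-- The boundary term of the energy identity depends continuously on the trace in `L²`. -/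
theorem tendsto_integral_boundaryForm {μ : Measure ℝ} {α : ℝ → ℝ}
    (hα : AEStronglyMeasurable (fun s => !₂[Real.cos (α s), Real.sin (α s)]) μ)
    {F : ℕ → ℝ → Spinor} {G : ℝ → Spinor} (hF : ∀ n, MemLp (F n) 2 μ) (hG : MemLp G 2 μ)
    (h : Tendsto (fun n => eLpNorm (fun s => F n s - G s) 2 μ) atTop (𝓝 0)) :
    Tendsto (fun n => ∫ s, (‖matAct (projPlus (α s)) (F n s)‖ ^ 2 -
        ‖matAct (projMinus (α s)) (F n s)‖ ^ 2) ∂μ) atTop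
      (𝓝 (∫ s, (‖matAct (projPlus (α s)) (G s)‖ ^ 2 -
        ‖matAct (projMinus (α s)) (G s)‖ ^ 2) ∂μ)) := by
  have hp : ∀ {f : ℝ → Spinor}, MemLp f 2 μ →
      MemLp (fun s => matAct (projPlus (α s)) (f s)) 2 μ := fun hf =>
    hf.of_le (aestronglyMeasurable_projPlus hα hf.1)
      (Eventually.of_forall fun s => norm_projPlus_le _ _)
  have hm : ∀ {f : ℝ → Spinor}, MemLp f 2 μ →
      MemLp (fun s => matAct (projMinus (α s)) (f s)) 2 μ := fun hf => by
    simp_rw [matAct_projMinus_eq]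
    exact hf.sub (hp hf)
  -- Pointwise contractions preserve `L²` convergence.
  have hlim : ∀ P : ℝ → Matrix (Fin 2) (Fin 2) ℂ, (∀ t v, ‖matAct (P t) v‖ ≤ ‖v‖) →
      Tendsto (fun n => eLpNorm (fun s => matAct (P (α s)) (F n s) - matAct (P (α s)) (G s)) 2 μ)
        atTop (𝓝 0) := fun P hP =>
    tendsto_of_tendsto_of_tendsto_of_le_of_le tendsto_const_nhds h (fun _ => zero_le) fun n =>
      eLpNorm_mono fun s => by
        rw [← map_sub]
        exact hP _ _
  have key := (tendsto_integral_norm_sq (fun n => hp (hF n)) (hp hG)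
    (hlim projPlus norm_projPlus_le)).sub
    (tendsto_integral_norm_sq (fun n => hm (hF n)) (hm hG) (hlim projMinus norm_projMinus_le))
  rw [integral_sub ((hp hG).integrable_norm_pow two_ne_zero)
    ((hm hG).integrable_norm_pow two_ne_zero)]
  refine key.congr fun n => ?_
  rw [integral_sub ((hp (hF n)).integrable_norm_pow two_ne_zero)
    ((hm (hF n)).integrable_norm_pow two_ne_zero)]

theorem lemma3p1 (Ω : TopologicalSpace.Opens Plane)
    (hΩc : IsConnected (Ω : Set Plane))
    (hΩb : Bornology.IsBounded (Ω : Set Plane))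
    (hΩ3 : HasC3Boundary (Ω : Set Plane))
    (L : ℝ) (γ : ℝ → Plane) (hγ : IsArcLengthParam (Ω : Set Plane) L γ)
    (α : ℝ → ℝ) (hα : ∀ s ∈ Set.Ico 0 L,
      IsOutwardUnitNormal (Ω : Set Plane) (γ s) !₂[Real.cos (α s), Real.sin (α s)])
    (M : ℝ) (hM : 0 < M) (ψ : (diracHM Ω M).domain) :
    (∃ τ : ℝ → Spinor, IsBoundaryTrace L γ ψ τ) ∧
    ∀ τ : ℝ → Spinor, IsBoundaryTrace L γ ψ τ →
      ‖diracHM Ω M ψ‖ ^ 2 =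
        (∫ x : Plane, ∑ j : Fin 2, ‖weakDeriv (planeBasis j) ψ x‖ ^ 2) +
          M ^ 2 * (∫ x in (Ω : Set Plane)ᶜ, ‖(ψ : SpinorL2) x‖ ^ 2) -
          M * ∫ s in (0 : ℝ)..L,
            (‖matAct (projPlus (α s)) (τ s)‖ ^ 2 - ‖matAct (projMinus (α s)) (τ s)‖ ^ 2) := by
  refine ⟨exists_isBoundaryTrace Ω.isOpen hΩb hΩ3 hγ hα ψ, ?_⟩
  rintro τ ⟨hτ, φ, hφ, hdφ, hφτ⟩
  -- The approximating sequence is the one that comes with `τ`, so the identity follows for every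
  -- trace without a separate uniqueness argument.
  have hbd := tendsto_integral_boundaryForm (aestronglyMeasurable_normal hΩ3 hγ hα)
    (fun n => memLp_boundary (φ n) hγ) hτ hφτ
  have hl := (((continuous_diracAction Ω M).tendsto _).comp
    (hφ.prodMk_nhds ((hdφ 0).prodMk_nhds (hdφ 1)))).norm.pow 2
  have hr := ((((hdφ 0).norm.pow 2).add ((hdφ 1).norm.pow 2)).add
    (((((continuous_cutOutside Ω).tendsto _).comp hφ).norm.pow 2).const_mul (M ^ 2))).sub
      (hbd.const_mul M)
  have hint : ∀ u : SpinorL2, Integrable fun x => ‖u x‖ ^ 2 := fun u =>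
    (Lp.memLp u).integrable_norm_pow two_ne_zero
  rw [intervalIntegral.integral_of_le hγ.exists_finite.1, ← integral_Ico_eq_integral_Ioc,
    ← norm_sq_cutOutside, integral_finsetSum _ fun _ _ => hint _, Fin.sum_univ_two,
    ← norm_sq_eq_integral, ← norm_sq_eq_integral, diracHM_eq_diracAction]
  refine tendsto_nhds_unique hl (hr.congr fun n => ?_)
  exact (norm_sq_diracAction_schwartz Ω hΩb hΩ3 hγ hα M (φ n)).symm
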